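/- Let $\mathcal{O}\subset\mathbb{R}^n$ be a bounded convex open set with $C^\infty$ boundary, let $p,q\in\mathbb{R}^n\setminus\overline{\mathcal{O}}$, and assume that the line segment from $p$ to $q$ meets $\mathcal{O}$. Put $I=[0,1]$, let $$\mathcal{A}=\{\mathbf{u}\in H^1(I,\mathbb{R}^n) : \mathbf{u}(0)=p,\ \mathbf{u}(1)=q,\ \mathbf{u}(t)\notin\mathcal{O}\text{ for all }t\in I\}$$ (elements of $H^1$ being identified with their continuous representatives), and let $E(\mathbf{u})=\int_I|\mathbf{u}'(t)|^2\,dt$. For a point $x\notin\overline{\mathcal{O}}$ let the vision cone $\mathcal{C}_x$ be the cone with apex $x$ tangent to $\mathcal{O}$, that is, the boundary of $\{x+t(y-x): y\in\overline{\mathcal{O}},\ t\ge 0\}$, and let the vision boundary be $\Gamma_x=\mathcal{C}_x\cap\partial\mathcal{O}$. Let $\mathbf{u}$ be any minimizer of $E$ over $\mathcal{A}$. Then there are $0<a<b<1$ such that 1. the coincidence set $\{t\in I:\mathbf{u}(t)\in\partial\mathcal{O}\}$ equals $[a,b]$; 2. $\mathbf{u}(a)\in\Gamma_p$, and on $[0,a]$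 the curve $\mathbf{u}$ is the affine parametrization of the line segment from $p$ to $\mathbf{u}(a)$; 3. $\mathbf{u}|_{[a,b]}$ is a minimizing geodesic on $\partial\mathcal{O}$ from $\mathbf{u}(a)$ to $\mathbf{u}(b)$: it is a $C^\infty$ curve in $\partial\mathcal{O}$ whose acceleration $\mathbf{u}''$ is everywhere normal to $\partial\mathcal{O}$, and its length is at most that of any continuous curve in $\partial\mathcal{O}$ with the same endpoints; 4. $\mathbf{u}(b)\in\Gamma_q$, and on $[b,1]$ the curve $\mathbf{u}$ is the affine parametrization of the line segment from $\mathbf{u}(b)$ to $q$. -/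

import Mathlib

open Set MeasureTheory
open scoped ContDiff

namespace Obstacle

/-- `ℝⁿ` with its Euclidean norm. -/
abbrev Rn (n : ℕ) : Type := EuclideanSpace ℝ (Fin n)

/-- The open set `O` has a `C^∞` boundary: near each boundary point, `O` is the sublevel set
`{φ < 0}` of a `C^∞` function `φ` whose differential at that point does not vanish. -/
def HasSmoothBoundary {n : ℕ} (O : Set (Rn n)) : Prop :=
  ∀ x ∈ frontier O, ∃ (U : Set (Rn n)) (φ : Rn n → ℝ),
    IsOpen U ∧ x ∈ U ∧ ContDiffOn ℝ ∞ φ U ∧ fderiv ℝ φ x ≠ 0 ∧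
      ∀ y ∈ U, (y ∈ O ↔ φ y < 0)

/-- `g` is a weak derivative of `u` on the open interval `(0,1)`, tested against
`C_c^∞((0,1))`. -/
def HasWeakDeriv {n : ℕ} (u g : ℝ → Rn n) : Prop :=
  ∀ φ : ℝ → ℝ, ContDiff ℝ ∞ φ → HasCompactSupport φ → tsupport φ ⊆ Ioo 0 1 →
    ∫ t in Ioo (0 : ℝ) 1, deriv φ t • u t = - ∫ t in Ioo (0 : ℝ) 1, φ t • g t

/-- `u ∈ H¹(I, ℝⁿ)` with `I = [0,1]`: both `u` and a weak derivative of `u` are square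
integrable. -/
def MemH1 {n : ℕ} (u : ℝ → Rn n) : Prop :=
  MemLp u 2 (volume.restrict (Ioo (0 : ℝ) 1)) ∧
    ∃ g : ℝ → Rn n, MemLp g 2 (volume.restrict (Ioo (0 : ℝ) 1)) ∧ HasWeakDeriv u g

open Classical in
/-- The square integrable weak derivative of `u` on `(0,1)` (`0` if there is none). It is unique
almost everywhere, see `weakDeriv_ae_eq`. -/
noncomputable def weakDeriv {n : ℕ} (u : ℝ → Rn n) : ℝ → Rn n :=
  if h : ∃ g : ℝ → Rn n, MemLp g 2 (volume.restrict (Ioo (0 : ℝ) 1)) ∧ HasWeakDeriv u g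
    then h.choose else 0

/-- The choice in `weakDeriv` is immaterial. -/
theorem weakDeriv_ae_eq {n : ℕ} {u g : ℝ → Rn n}
    (hg : MemLp g 2 (volume.restrict (Ioo (0 : ℝ) 1))) (h : HasWeakDeriv u g) :
    weakDeriv u =ᵐ[volume.restrict (Ioo (0 : ℝ) 1)] g := by
  have hex : ∃ g : ℝ → Rn n,
      MemLp g 2 (volume.restrict (Ioo (0 : ℝ) 1)) ∧ HasWeakDeriv u g := ⟨g, hg, h⟩
  have hw : weakDeriv u = hex.choose := by
    unfold weakDeriv
    rw [dif_pos hex]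
  obtain ⟨hk, hk'⟩ := hex.choose_spec
  rw [hw]
  set k := hex.choose
  have ik : IntegrableOn k (Ioo (0 : ℝ) 1) := hk.integrable (by norm_num)
  have ig : IntegrableOn g (Ioo (0 : ℝ) 1) := hg.integrable (by norm_num)
  have key := IsOpen.ae_eq_zero_of_integral_contDiff_smul_eq_zero (μ := (volume : Measure ℝ))
    (f := fun t => k t - g t) (isOpen_Ioo (a := (0 : ℝ)) (b := 1))
    ((ik.sub ig).locallyIntegrableOn) (by
      intro φ hφ hc hs
      have hφc : Continuous φ := hφ.continuous
      obtain ⟨C, hC⟩ := hc.exists_bound_of_continuous hφc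
      have i1 : IntegrableOn (fun t => φ t • k t) (Ioo (0 : ℝ) 1) :=
        ik.bdd_smul C hφc.aestronglyMeasurable (Filter.Eventually.of_forall hC)
      have i2 : IntegrableOn (fun t => φ t • g t) (Ioo (0 : ℝ) 1) :=
        ig.bdd_smul C hφc.aestronglyMeasurable (Filter.Eventually.of_forall hC)
      have e : ∫ t, φ t • (k t - g t) = ∫ t in Ioo (0 : ℝ) 1, φ t • (k t - g t) := by
        symm
        apply setIntegral_eq_integral_of_forall_compl_eq_zero
        intro t ht
        have : φ t = 0 := by
          by_contra h0
          exact ht (hs (subset_tsupport φ h0))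
        simp [this]
      rw [e]
      simp only [smul_sub]
      rw [integral_sub i1 i2, sub_eq_zero]
      exact neg_injective ((hk' φ hφ hc hs).symm.trans (h φ hφ hc hs)))
  rw [Filter.EventuallyEq, ae_restrict_iff' measurableSet_Ioo]
  filter_upwards [key] with t ht hmem
  exact sub_eq_zero.1 (ht hmem)

/-- The energy `E(u) = ∫_I |u'|²`. -/
noncomputable def energy {n : ℕ} (u : ℝ → Rn n) : ℝ :=
  ∫ t in Ioo (0 : ℝ) 1, ‖weakDeriv u t‖ ^ 2

/-- The admissible set: `H¹` curves on `[0,1]` from `p` to `q` that do not enter `O`.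
An element of `H¹(I)` is represented by its continuous representative on `[0,1]`; the values of
`u : ℝ → ℝⁿ` outside `[0,1]` play no role. -/
def admissible {n : ℕ} (O : Set (Rn n)) (p q : Rn n) : Set (ℝ → Rn n) :=
  {u | MemH1 u ∧ ContinuousOn u (Icc 0 1) ∧ u 0 = p ∧ u 1 = q ∧ ∀ t ∈ Icc (0 : ℝ) 1, u t ∉ O}

/-- `u` minimizes the energy over the admissible set. -/
def IsEnergyMinimizer {n : ℕ} (O : Set (Rn n)) (p q : Rn n) (u : ℝ → Rn n) : Prop :=
  u ∈ admissible O p q ∧ ∀ v ∈ admissible O p q, energy u ≤ energy v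

/-- The full cone with apex `p` spanned by the closure of `O`. -/
def solidCone {n : ℕ} (O : Set (Rn n)) (p : Rn n) : Set (Rn n) :=
  {x | ∃ y ∈ closure O, ∃ t : ℝ, 0 ≤ t ∧ x = p + t • (y - p)}

/-- The vision cone of `p`: the cone (surface) with apex `p` that is tangent to `O`. -/
def visionCone {n : ℕ} (O : Set (Rn n)) (p : Rn n) : Set (Rn n) :=
  frontier (solidCone O p)

/-- The vision boundary of `p`. -/
def visionBoundary {n : ℕ} (O : Set (Rn n)) (p : Rn n) : Set (Rn n) :=
  visionCone O p ∩ frontier O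

/-- The vectors tangent at `x` to a smooth hypersurface `S`: velocities at `x` of smooth curves
in `S`. -/
def tangentVectors {n : ℕ} (S : Set (Rn n)) (x : Rn n) : Set (Rn n) :=
  {v | ∃ (ε : ℝ) (c : ℝ → Rn n), 0 < ε ∧ ContDiffOn ℝ ∞ c (Ioo (-ε) ε) ∧
    (∀ s ∈ Ioo (-ε) ε, c s ∈ S) ∧ c 0 = x ∧ deriv c 0 = v}

/-- `γ` restricted to `[a,b]` is a geodesic of the smooth hypersurface `S ⊆ ℝⁿ` with the induced
metric: a smooth curve in `S` whose covariant acceleration, the tangential part of `γ''`,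
vanishes. -/
def IsGeodesicOn {n : ℕ} (S : Set (Rn n)) (γ : ℝ → Rn n) (a b : ℝ) : Prop :=
  ContDiffOn ℝ ∞ γ (Icc a b) ∧ (∀ t ∈ Icc a b, γ t ∈ S) ∧
    ∀ t ∈ Icc a b, ∀ v ∈ tangentVectors S (γ t),
      inner ℝ (iteratedDerivWithin 2 γ (Icc a b) t) v = 0

/-- `γ` restricted to `[a,b]` is a minimizing geodesic of `S`: a geodesic whose length is at most
the length of every continuous curve in `S` with the same endpoints. -/
def IsMinimizingGeodesicOn {n : ℕ} (S : Set (Rn n)) (γ : ℝ → Rn n) (a b : ℝ) : Prop :=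
  IsGeodesicOn S γ a b ∧
    ∀ σ : ℝ → Rn n, ContinuousOn σ (Icc a b) → (∀ t ∈ Icc a b, σ t ∈ S) →
      σ a = γ a → σ b = γ b → eVariationOn γ (Icc a b) ≤ eVariationOn σ (Icc a b)

end Obstacle

/-! Two kinds of competitor suffice, and convexity makes both admissible.

The first moves `u` on a subinterval `[c,d]` towards its chord. With `m` the mean of `u'` there, `u'
- m` is orthogonal to constants, so the energy on `[c,d]` of the curve with derivative `m + s • (u'
- m)` is `(d-c)‖m‖² + s²R`, where `R = ∫ ‖u' - m‖²`. Any step towards the chord that avoids `O`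
strictly lowers the energy unless `R = 0`. This property, `IsTaut`, gives the whole shape of `u`.
Off `closure O` the curve is affine. It cannot leave `closure O` and return, because the points
within a given distance of a convex set form a convex set. The contact set is therefore an interval
`[a,b]`. If `p` were strictly outside the tangent half-space at `u a`, the chord from `p` to a
slightly later contact point would avoid `O` by the supporting hyperplane there; `u` would follow
that chord and run into `O` just after `a`. So the first segment is tangent, and reversing time
treats `b`.

The second moves `u` on the contact interval by `s • ψ(t) • T(t)`, with `T(t)` tangent to the
boundary at `u t`. The moved point lies on the supporting hyperplane at `u t`, which misses `O`;
hence every real `s` is allowed and the first variation vanishes exactly. The resulting weak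
Euler-Lagrange equation says that `u''` is normal. Integrated once, it shows that `u'` has a
continuous representative; a bootstrap in the geodesic equation then gives smoothness
(`IsBoundaryArc.exists_ae_eq`, `IsBoundaryArc.exists_velocity`, `IsBoundaryArc.contDiffOn`).

Length is compared through energy: a rectifiable rival in the boundary is reparametrized with speed
bounded by its length over `b - a`, and Cauchy-Schwarz turns the energy inequality into a length
inequality. All of this rests on `MemH1.isPrimitiveOn`, by which a continuous `H¹` curve is the
integral of its weak derivative, so that competitors can be glued in. -/

namespace Obstacle

open Filter Topology

local notation "⟪" x ", " y "⟫" => inner ℝ x y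

/-! ### Normal fields of a smooth convex boundary -/

/-- `N` is a smooth unit field on the ball of radius `r` about `x` which restricts to the outward
unit normal of the convex set `O` on `frontier O`: it supports `O`, and a curve that leaves a
boundary point with an inward velocity enters `O`. -/
structure IsNormalField {n : ℕ} (O : Set (Rn n)) (x : Rn n) (r : ℝ) (N : Rn n → Rn n) : Prop where
  contDiffOn : ContDiffOn ℝ ∞ N (Metric.ball x r)
  norm_eq_one : ∀ y ∈ Metric.ball x r, ‖N y‖ = 1
  inner_neg : ∀ y ∈ Metric.ball x r, y ∈ frontier O → ∀ z ∈ O, ⟪N y, z - y⟫ < 0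
  eventually_mem : ∀ y ∈ Metric.ball x r, y ∈ frontier O → ∀ (c : ℝ → Rn n) (v : Rn n) (t : ℝ),
    c t = y → HasDerivWithinAt c v (Ioi t) t → ⟪N y, v⟫ < 0 → ∀ᶠ s in 𝓝[>] t, c s ∈ O

theorem eventually_neg_of_hasDerivWithinAt {f : ℝ → ℝ} {f' t : ℝ}
    (hf : HasDerivWithinAt f f' (Ioi t) t) (h0 : f t = 0) (hneg : f' < 0) :
    ∀ᶠ s in 𝓝[>] t, f s < 0 := by
  have h := (hasDerivWithinAt_iff_tendsto_slope' (by simp)).1 hf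
  filter_upwards [h.eventually (gt_mem_nhds hneg), self_mem_nhdsWithin] with s hs hst
  rw [slope_def_field, h0, sub_zero] at hs
  have : 0 < s - t := sub_pos.2 hst
  by_contra hcon
  exact absurd hs (not_lt.2 (div_nonneg (not_lt.1 hcon) this.le))

/-- The field is the normalized gradient of a local defining function `φ`, which vanishes on the
boundary; the chain rule shows that inward curves enter `O`. Strict support combines this with
convexity: if some `z ∈ O` had `0 ≤ ⟪N y, z - y⟫`, points of `O` on opposite sides of `y` would put
`y` itself in `O`. -/
theorem exists_isNormalField {n : ℕ} {O : Set (Rn n)} (hO : IsOpen O) (hconv : Convex ℝ O)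
    (hsm : HasSmoothBoundary O) {x : Rn n} (hx : x ∈ frontier O) :
    ∃ r > 0, ∃ N : Rn n → Rn n, IsNormalField O x r N := by
  obtain ⟨U, φ, hU, hxU, hφ, hφx, hφO⟩ := hsm x hx
  have hD : ContDiffOn ℝ ∞ (fderiv ℝ φ) U := hφ.fderiv_of_isOpen hU (by simp)
  obtain ⟨r, hr, hball⟩ : ∃ r > 0, Metric.ball x r ⊆ U ∩ {y | fderiv ℝ φ y ≠ 0} := by
    have h1 : ∀ᶠ y in 𝓝 x, fderiv ℝ φ y ≠ 0 :=
      (hD.continuousOn.continuousAt (hU.mem_nhds hxU)).eventually_ne hφx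
    exact Metric.mem_nhds_iff.1 (inter_mem (hU.mem_nhds hxU) h1)
  set L := (InnerProductSpace.toDual ℝ (Rn n)).symm
  have hL : ContDiff ℝ ∞ L := by
    let L' : StrongDual ℝ (Rn n) →ₗ[ℝ] Rn n :=
      { toFun := L, map_add' := map_add L, map_smul' := fun c x => by simp }
    exact L'.toContinuousLinearMap.contDiff
  set N : Rn n → Rn n := fun y => ‖fderiv ℝ φ y‖⁻¹ • L (fderiv ℝ φ y)
  have hNpos : ∀ y ∈ Metric.ball x r, 0 < ‖fderiv ℝ φ y‖ := fun y hy => norm_pos_iff.2 (hball hy).2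
  have hNin : ∀ y v, ⟪N y, v⟫ = ‖fderiv ℝ φ y‖⁻¹ * fderiv ℝ φ y v := by
    intro y v
    simp only [N, L]
    rw [real_inner_smul_left, InnerProductSpace.toDual_symm_apply]
  have hnorm : ∀ y ∈ Metric.ball x r, ‖N y‖ = 1 := by
    intro y hy
    simp only [N, norm_smul, norm_inv, norm_norm, LinearIsometryEquiv.norm_map]
    exact inv_mul_cancel₀ (hNpos y hy).ne'
  have hzero : ∀ y ∈ Metric.ball x r, y ∈ frontier O → φ y = 0 := by
    intro y hy hyf
    apply le_antisymm
    · have hcl : y ∈ closure (O ∩ U) := by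
        have := frontier_subset_closure hyf
        rw [inter_comm]
        exact hU.inter_closure ⟨(hball hy).1, this⟩
      have hc : ContinuousWithinAt φ (O ∩ U) y :=
        (hφ.continuousOn y (hball hy).1).mono inter_subset_right
      exact hc.closure_le hcl continuousWithinAt_const (fun z hz => ((hφO z hz.2).1 hz.1).le)
    · by_contra hcon
      have : y ∈ O := (hφO y (hball hy).1).2 (not_le.1 hcon)
      rw [hO.frontier_eq] at hyf
      exact hyf.2 this
  have henter : ∀ y ∈ Metric.ball x r, y ∈ frontier O → ∀ (c : ℝ → Rn n) (v : Rn n) (t : ℝ),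
      c t = y → HasDerivWithinAt c v (Ioi t) t → ⟪N y, v⟫ < 0 → ∀ᶠ s in 𝓝[>] t, c s ∈ O := by
    intro y hy hyf c v t hct hc hv
    have hyU := (hball hy).1
    have hd : HasFDerivAt φ (fderiv ℝ φ y) y :=
      ((hφ.contDiffAt (hU.mem_nhds hyU)).differentiableAt (by simp)).hasFDerivAt
    subst hct
    have hcomp := hd.comp_hasDerivWithinAt t hc
    have hneg : fderiv ℝ φ (c t) v < 0 := by
      rw [hNin] at hv
      by_contra hcon
      exact absurd hv (not_lt.2 (mul_nonneg (inv_nonneg.2 (norm_nonneg _)) (not_lt.1 hcon)))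
    filter_upwards [eventually_neg_of_hasDerivWithinAt hcomp (hzero _ hy hyf) hneg,
      hc.continuousWithinAt.eventually (hU.mem_nhds hyU)] with s hs hsU
    exact (hφO _ hsU).2 hs
  refine ⟨r, hr, N, ?_, hnorm, ?_, henter⟩
  · have hD' := hD.mono (fun y hy => (hball hy).1)
    have hLD := hL.comp_contDiffOn hD'
    have hLn : ∀ y, ‖fderiv ℝ φ y‖ = ‖L (fderiv ℝ φ y)‖ := fun y => (L.norm_map _).symm
    simp only [N]
    simp only [hLn]
    exact ((hLD.norm ℝ fun y hy => by simpa using (hball hy).2).inv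
      (fun y hy => by simpa using (hball hy).2)).smul hLD
  · intro y hy hyf z hz
    by_contra hcon
    push Not at hcon
    have hyO : y ∉ O := by
      rw [hO.frontier_eq] at hyf
      exact hyf.2
    -- Pushing `z` slightly along `N y` makes the inequality strict, so that the opposite direction
    -- `w` points inward.
    obtain ⟨ε, hε, hεO⟩ : ∃ ε > (0 : ℝ), z + ε • N y ∈ O := by
      have : Tendsto (fun ε : ℝ => z + ε • N y) (𝓝[>] 0) (𝓝 (z + (0 : ℝ) • N y)) :=
        (Continuous.tendsto (by fun_prop) 0).mono_left nhdsWithin_le_nhds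
      have h2 := this.eventually (hO.mem_nhds (by simpa using hz))
      obtain ⟨ε, h3, h4⟩ := (h2.and self_mem_nhdsWithin).exists
      exact ⟨ε, h4, h3⟩
    set w := y - (z + ε • N y)
    have hw : ⟪N y, w⟫ < 0 := by
      have : w = -(z - y) - ε • N y := by simp only [w]; abel
      rw [this, inner_sub_right, inner_neg_right, real_inner_smul_right,
        real_inner_self_eq_norm_sq, hnorm y hy]
      linarith
    have hder : HasDerivWithinAt (fun s : ℝ => y + s • w) w (Ioi 0) 0 := by
      have := ((hasDerivAt_id (0 : ℝ)).smul_const w).const_add y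
      simpa using this.hasDerivWithinAt
    obtain ⟨s, hsO, hs⟩ :=
      ((henter y hy hyf _ w 0 (by simp) hder hw).and self_mem_nhdsWithin).exists
    have hs : 0 < s := hs
    apply hyO
    -- `(1 + s) • y = (y + s • w) + s • (y - w)`, and both points on the right lie in `O`.
    have := hconv hsO hεO (a := 1 / (1 + s)) (b := s / (1 + s)) (by positivity) (by positivity)
      (by field_simp)
    convert this using 1
    have hz' : z + ε • N y = y - w := by simp only [w]; abel
    rw [hz']
    have h1 : (1 : ℝ) + s ≠ 0 := by positivity
    have : y = ((1 / (1 + s)) + (s / (1 + s))) • y := by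
      rw [show 1 / (1 + s) + s / (1 + s) = 1 by field_simp, one_smul]
    nth_rw 1 [this]
    rw [show (1 / (1 + s)) • (y + s • w) = (1 / (1 + s)) • y + (s / (1 + s)) • w by
      rw [smul_add, smul_smul]; congr 2; field_simp]
    module

/-! ### Taut curves: contact interval and tangency -/

/-- A curve on `[0,1]` that avoids `O` and that agrees with its chord over a subinterval whenever
it can be moved towards the chord without entering `O`. -/
structure IsTaut {n : ℕ} (O : Set (Rn n)) (v : ℝ → Rn n) : Prop where
  continuousOn : ContinuousOn v (Icc 0 1)
  notMem : ∀ t ∈ Icc (0 : ℝ) 1, v t ∉ O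
  eq_chord : ∀ c d ε : ℝ, 0 ≤ c → c < d → d ≤ 1 → 0 < ε → ε ≤ 1 →
    (∀ t ∈ Icc c d,
      (1 - ε) • v t + ε • AffineMap.lineMap (v c) (v d) ((t - c) / (d - c)) ∉ O) →
    ∀ t ∈ Icc c d, v t = AffineMap.lineMap (v c) (v d) ((t - c) / (d - c))

namespace IsTaut

variable {n : ℕ} {O : Set (Rn n)} {v : ℝ → Rn n}

/-- Lets every statement about the first contact time be reused at the last one. -/
theorem reverse (hv : IsTaut O v) : IsTaut O (fun t => v (1 - t)) where
  continuousOn := hv.continuousOn.comp (by fun_prop) (fun t ht => ⟨by linarith [ht.2], by linarith [ht.1]⟩)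
  notMem t ht := hv.notMem _ ⟨by linarith [ht.2], by linarith [ht.1]⟩
  eq_chord c d ε hc hcd hd hε hε1 h t ht := by
    have key : ∀ t, AffineMap.lineMap (v (1 - c)) (v (1 - d)) ((t - c) / (d - c)) =
        AffineMap.lineMap (v (1 - d)) (v (1 - c)) ((1 - t - (1 - d)) / (1 - c - (1 - d))) := by
      intro t
      rw [← AffineMap.lineMap_apply_one_sub]
      congr 1
      have : d - c ≠ 0 := by linarith
      rw [show 1 - c - (1 - d) = d - c by ring]
      field_simp
      ring
    rw [key]
    refine hv.eq_chord (1 - d) (1 - c) ε (by linarith) (by linarith) (by linarith) hε hε1 ?_ (1 - t)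
      ⟨by linarith [ht.2], by linarith [ht.1]⟩
    intro s hs
    have := h (1 - s) ⟨by linarith [hs.2], by linarith [hs.1]⟩
    rw [key] at this
    simpa using this

/-- The arc is compact, hence at positive distance `δ` from `closure O`; a small enough step towards
the chord is free. -/
theorem eq_chord_of_notMem_closure (hv : IsTaut O v) {c d : ℝ} (hc : 0 ≤ c) (hcd : c < d)
    (hd : d ≤ 1) (h : ∀ t ∈ Icc c d, v t ∉ closure O) :
    ∀ t ∈ Icc c d, v t = AffineMap.lineMap (v c) (v d) ((t - c) / (d - c)) := by
  have hvc : ContinuousOn v (Icc c d) := hv.continuousOn.mono (Icc_subset_Icc hc hd)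
  obtain ⟨δ, hδ, hsub⟩ := (isCompact_Icc.image_of_continuousOn hvc).exists_thickening_subset_open
    isClosed_closure.isOpen_compl (by rintro _ ⟨t, ht, rfl⟩; exact h t ht)
  set ℓ : ℝ → Rn n := fun t => AffineMap.lineMap (v c) (v d) ((t - c) / (d - c))
  have hℓ : Continuous ℓ := by
    simp only [ℓ, AffineMap.lineMap_apply_module]
    fun_prop
  obtain ⟨M, hM⟩ := isCompact_Icc.exists_bound_of_continuousOn (hℓ.continuousOn.sub hvc)
  have hM0 : 0 < |M| + 1 := by positivity
  -- With this `ε` no point moves by more than `δ / 2`; `|M| + 1` is positive whatever the sign of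
  -- the bound `M`.
  refine hv.eq_chord c d (min 1 (δ / (|M| + 1) / 2)) hc hcd hd (by positivity) (min_le_left _ _) ?_
  intro t ht hmem
  set ε := min 1 (δ / (|M| + 1) / 2)
  have hε : 0 < ε := by positivity
  refine hsub (a := (1 - ε) • v t + ε • ℓ t) ?_ (subset_closure hmem)
  rw [Metric.mem_thickening_iff]
  refine ⟨v t, mem_image_of_mem _ ht, ?_⟩
  rw [dist_eq_norm, show (1 - ε) • v t + ε • ℓ t - v t = ε • (ℓ t - v t) by module, norm_smul,
    Real.norm_of_nonneg hε.le]
  calc ε * ‖ℓ t - v t‖ ≤ (δ / (|M| + 1) / 2) * (|M| + 1) := by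
        refine mul_le_mul (min_le_right _ _) ?_ (norm_nonneg _) (by positivity)
        exact (hM t ht).trans (by linarith [le_abs_self M])
    _ = δ / 2 := by field_simp
    _ < δ := by linarith

/-- A taut curve cannot leave the closure of the convex set `O` and come back. -/
theorem exists_mem_closure (hconv : Convex ℝ O) (hv : IsTaut O v) {s r : ℝ} (hs : 0 ≤ s)
    (hsr : s < r) (hr : r ≤ 1) (hvs : v s ∈ closure O) (hvr : v r ∈ closure O) :
    ∃ t ∈ Ioo s r, v t ∈ closure O := by
  by_contra! h
  have hne : (closure O).Nonempty := ⟨_, hvs⟩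
  have hvc : ContinuousOn v (Icc s r) := hv.continuousOn.mono (Icc_subset_Icc hs hr)
  set f : ℝ → ℝ := fun t => Metric.infDist (v t) (closure O)
  have hf : ContinuousOn f (Icc s r) := (Metric.continuous_infDist_pt _).comp_continuousOn hvc
  set t := (s + r) / 2
  have ht : t ∈ Ioo s r := ⟨by simp only [t]; linarith, by simp only [t]; linarith⟩
  have hft : 0 < f t := (isClosed_closure.notMem_iff_infDist_pos hne).1 (h t ht)
  have hfs : f s = 0 := Metric.infDist_zero_of_mem hvs
  have hfr : f r = 0 := Metric.infDist_zero_of_mem hvr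
  -- The end points are moved inside `(s,r)`, where the curve is off `closure O` and hence affine,
  -- while staying closer to `closure O` than `v t`. Convexity of the open thickening of radius `f
  -- t` then contradicts the definition of `f t`.
  obtain ⟨s', hs', hss', hs't⟩ : ∃ s', f s' < f t ∧ s < s' ∧ s' < t := by
    have h1 : Tendsto f (𝓝[>] s) (𝓝 (f s)) :=
      (hf s (left_mem_Icc.2 hsr.le)).mono_left (nhdsWithin_le_of_mem (Icc_mem_nhdsGT hsr))
    obtain ⟨s', h2, h3⟩ := ((h1.eventually (gt_mem_nhds (hfs ▸ hft))).and
      (Ioo_mem_nhdsGT ht.1)).exists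
    exact ⟨s', h2, h3.1, h3.2⟩
  obtain ⟨r', hr', htr', hr'r⟩ : ∃ r', f r' < f t ∧ t < r' ∧ r' < r := by
    have h1 : Tendsto f (𝓝[<] r) (𝓝 (f r)) :=
      (hf r (right_mem_Icc.2 hsr.le)).mono_left (nhdsWithin_le_of_mem (Icc_mem_nhdsLT hsr))
    obtain ⟨s', h2, h3⟩ := ((h1.eventually (gt_mem_nhds (hfr ▸ hft))).and
      (Ioo_mem_nhdsLT ht.2)).exists
    exact ⟨s', h2, h3.1, h3.2⟩
  have hlin := hv.eq_chord_of_notMem_closure (c := s') (d := r') (by linarith) (by linarith)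
    (by linarith) (fun τ hτ => h τ ⟨by linarith [hτ.1], by linarith [hτ.2]⟩) t
    ⟨hs't.le, htr'.le⟩
  set θ := (t - s') / (r' - s')
  have hθ0 : 0 ≤ θ := div_nonneg (by linarith) (by linarith)
  have hθ1 : θ ≤ 1 := (div_le_one (by linarith)).2 (by linarith)
  have hmem : v t ∈ Metric.thickening (f t) (closure O) := by
    rw [hlin, AffineMap.lineMap_apply_module]
    exact (hconv.closure.thickening (f t))
      ((Metric.mem_thickening_iff_infDist_lt hne).2 hs')
      ((Metric.mem_thickening_iff_infDist_lt hne).2 hr') (sub_nonneg.2 hθ1) hθ0 (by ring)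
  exact lt_irrefl _ ((Metric.mem_thickening_iff_infDist_lt hne).1 hmem)

/-- The curve is affine on `[0,c]` for every `c < a`; let `c` tend to `a`. -/
theorem eq_lineMap_of_Ico (hv : IsTaut O v) {a : ℝ} (ha : 0 < a) (ha1 : a ≤ 1)
    (h : ∀ t ∈ Ico 0 a, v t ∉ closure O) :
    ∀ t ∈ Icc 0 a, v t = AffineMap.lineMap (v 0) (v a) (t / a) := by
  intro t ht
  rcases ht.2.eq_or_lt with rfl | hta
  · simp [div_self ha.ne']
  have hva : Tendsto v (𝓝[<] a) (𝓝 (v a)) :=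
    (hv.continuousOn a ⟨ha.le, ha1⟩).mono_left
      (nhdsWithin_le_of_mem (mem_of_superset (Icc_mem_nhdsLT ha) (Icc_subset_Icc_right ha1)))
  have hid : Tendsto (fun c : ℝ => t / c) (𝓝[<] a) (𝓝 (t / a)) :=
    (tendsto_const_nhds.div tendsto_id ha.ne').mono_left nhdsWithin_le_nhds
  have hlim : Tendsto (fun c => (AffineMap.lineMap (v 0) (v c) (t / c) : Rn n)) (𝓝[<] a)
      (𝓝 (AffineMap.lineMap (v 0) (v a) (t / a))) := by
    simp only [AffineMap.lineMap_apply_module]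
    exact ((tendsto_const_nhds.sub hid).smul tendsto_const_nhds).add (hid.smul hva)
  refine tendsto_nhds_unique (tendsto_const_nhds.congr' ?_) hlim
  filter_upwards [Ioo_mem_nhdsLT hta] with c hc
  have := hv.eq_chord_of_notMem_closure (c := 0) (d := c) le_rfl (by linarith [ht.1, hc.1])
    (by linarith [hc.2]) (fun τ hτ => h τ ⟨hτ.1, hτ.2.trans_lt hc.2⟩) t ⟨ht.1, hc.1.le⟩
  simpa using this

end IsTaut

theorem IsNormalField.inner_nonneg_of_segment {n : ℕ} {O : Set (Rn n)} {x : Rn n} {r : ℝ}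
    {N : Rn n → Rn n} (hN : IsNormalField O x r N) (hr : 0 < r) (hx : x ∈ frontier O) {p : Rn n}
    (h : ∀ t ∈ Ioo (0 : ℝ) 1, x + t • (p - x) ∉ O) : 0 ≤ ⟪N x, p - x⟫ := by
  by_contra! hcon
  have hder : HasDerivWithinAt (fun s : ℝ => x + s • (p - x)) (p - x) (Ioi 0) 0 := by
    have := ((hasDerivAt_id (0 : ℝ)).smul_const (p - x)).const_add x
    simpa using this.hasDerivWithinAt
  obtain ⟨s, hsO, hs⟩ := ((hN.eventually_mem x (Metric.mem_ball_self hr) hx _ _ 0 (by simp) hder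
    hcon).and (Ioo_mem_nhdsGT one_pos)).exists
  exact h s hs hsO

/-- The inner product is nonnegative because the incoming segment avoids `O`. If it were positive,
it would stay so at a contact time `d` just after `a`; the chord from `v 0` to `v d` then avoids
`O`, so `v` is affine on `[0,d]` and crosses `v a` with inward velocity. -/
theorem IsTaut.inner_eq_zero {n : ℕ} {O : Set (Rn n)} {v : ℝ → Rn n} (hv : IsTaut O v)
    {a b r : ℝ} {N : Rn n → Rn n} (ha : 0 < a) (hab : a < b) (hb : b ≤ 1)
    (hfr : ∀ t ∈ Icc a b, v t ∈ frontier O)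
    (hlin : ∀ t ∈ Icc 0 a, v t = AffineMap.lineMap (v 0) (v a) (t / a))
    (hr : 0 < r) (hN : IsNormalField O (v a) r N) : ⟪N (v a), v 0 - v a⟫ = 0 := by
  have hva := hfr a (left_mem_Icc.2 hab.le)
  apply le_antisymm
  · by_contra! hcon
    have hta : Tendsto v (𝓝[>] a) (𝓝 (v a)) :=
      (hv.continuousOn a ⟨ha.le, by linarith⟩).mono_left
        (nhdsWithin_le_of_mem (mem_of_superset (Icc_mem_nhdsGT hab) (Icc_subset_Icc ha.le hb)))
    have hNa : Tendsto (fun t => N (v t)) (𝓝[>] a) (𝓝 (N (v a))) :=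
      (hN.contDiffOn.continuousOn.continuousAt (Metric.ball_mem_nhds _ hr)).tendsto.comp hta
    have hin := (hNa.inner (tendsto_const_nhds.sub hta)).eventually (lt_mem_nhds hcon)
    obtain ⟨d, ⟨hd1, hd2⟩, hd3⟩ := ((hin.and (hta.eventually (Metric.ball_mem_nhds _ hr))).and
      (Ioo_mem_nhdsGT hab)).exists
    have hd0 : 0 < d := ha.trans hd3.1
    -- Here `ε = 1`: the arc is replaced by its chord outright, which lies in the closed half-space
    -- opposite to `O` at `v d`.
    have hchord := hv.eq_chord 0 d 1 le_rfl hd0 (by linarith [hd3.2]) one_pos le_rfl (by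
      intro t ht hmem
      have h1 := hN.inner_neg _ hd2 (hfr d ⟨hd3.1.le, hd3.2.le⟩) _ hmem
      rw [sub_self, zero_smul, zero_add, one_smul, AffineMap.lineMap_apply_module,
        show (1 - (t - 0) / (d - 0)) • v 0 + ((t - 0) / (d - 0)) • v d - v d
          = (1 - (t - 0) / (d - 0)) • (v 0 - v d) by module, real_inner_smul_right] at h1
      have : (t - 0) / (d - 0) ≤ 1 := (div_le_one (by linarith)).2 (by linarith [ht.2])
      exact absurd h1 (not_lt.2 (mul_nonneg (by linarith) hd1.le)))
    simp only [sub_zero, AffineMap.lineMap_apply_module'] at hchord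
    have hder : HasDerivWithinAt (fun t : ℝ => (t / d) • (v d - v 0) + v 0)
        ((1 / d) • (v d - v 0)) (Ioi a) a :=
      (((hasDerivAt_id a).div_const d).smul_const _ |>.add_const _).hasDerivWithinAt
    have hca := hchord a ⟨ha.le, hd3.1.le⟩
    have hneg : ⟪N (v a), (1 / d) • (v d - v 0)⟫ < 0 := by
      have : (1 / d) • (v d - v 0) = -((1 / a) • (v 0 - v a)) := by
        rw [hca, sub_add_cancel_right, smul_neg, neg_neg, smul_smul]
        congr 1
        field_simp
      rw [this, inner_neg_right, real_inner_smul_right]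
      have : 0 < 1 / a := by positivity
      nlinarith
    obtain ⟨s, hsO, hs⟩ := ((hN.eventually_mem _ (Metric.mem_ball_self hr) hva _ _ a hca.symm hder
      hneg).and (Ioo_mem_nhdsGT hd3.1)).exists
    rw [← hchord s ⟨ha.le.trans hs.1.le, hs.2.le⟩] at hsO
    exact hv.notMem s ⟨ha.le.trans hs.1.le, by linarith [hs.2, hd3.2]⟩ hsO
  · refine hN.inner_nonneg_of_segment hr hva fun t ht hmem => ?_
    have h1 := hlin (a * (1 - t)) ⟨mul_nonneg ha.le (by linarith [ht.2]), by nlinarith [ht.1]⟩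
    rw [mul_div_cancel_left₀ _ ha.ne', AffineMap.lineMap_apply_module] at h1
    refine hv.notMem (a * (1 - t)) ⟨mul_nonneg ha.le (by linarith [ht.2]),
      by nlinarith [ht.1]⟩ ?_
    convert hmem using 1
    rw [h1]
    module

/-- As `p` lies on the supporting hyperplane at `x`, the supporting half-space contains the whole
solid cone; the points `x + ε • N` are outside it, so `x` is not interior. -/
theorem mem_visionBoundary {n : ℕ} {O : Set (Rn n)} {x p N : Rn n} (hx : x ∈ frontier O)
    (hN : ‖N‖ = 1) (hO : ∀ z ∈ O, ⟪N, z - x⟫ < 0) (hp : ⟪N, p - x⟫ = 0) :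
    x ∈ visionBoundary O p := by
  refine ⟨⟨subset_closure ⟨x, frontier_subset_closure hx, 1, zero_le_one, by simp⟩, ?_⟩, hx⟩
  intro hint
  have hcl : ∀ z ∈ closure O, ⟪N, z - x⟫ ≤ 0 := by
    intro z hz
    have hcl : IsClosed {z : Rn n | ⟪N, z - x⟫ ≤ 0} :=
      isClosed_le (by fun_prop) continuous_const
    exact closure_minimal (fun z hz => (hO z hz).le) hcl hz
  have hcone : ∀ z ∈ solidCone O p, ⟪N, z - x⟫ ≤ 0 := by
    rintro z ⟨y, hy, t, ht, rfl⟩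
    rw [show p + t • (y - p) - x = (1 - t) • (p - x) + t • (y - x) by module, inner_add_right,
      real_inner_smul_right, real_inner_smul_right, hp, mul_zero, zero_add]
    exact mul_nonpos_of_nonneg_of_nonpos ht (hcl y hy)
  have : Tendsto (fun ε : ℝ => x + ε • N) (𝓝[>] 0) (𝓝 (x + (0 : ℝ) • N)) :=
    (Continuous.tendsto (by fun_prop) 0).mono_left nhdsWithin_le_nhds
  have h2 := this.eventually (isOpen_interior.mem_nhds (by simpa using hint))
  obtain ⟨ε, h3, h4⟩ := (h2.and self_mem_nhdsWithin).exists
  have h5 := hcone _ (interior_subset h3)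
  rw [add_sub_cancel_left, real_inner_smul_right, real_inner_self_eq_norm_sq, hN] at h5
  have : (0 : ℝ) < ε := h4
  linarith

/-- The shape of a taut curve whose end points do not see each other. -/
theorem IsTaut.exists_coincidence {n : ℕ} {O : Set (Rn n)} {v : ℝ → Rn n} (hv : IsTaut O v)
    (hO : IsOpen O) (hconv : Convex ℝ O) (hsm : HasSmoothBoundary O)
    (h0 : v 0 ∉ closure O) (h1 : v 1 ∉ closure O) (hseg : (segment ℝ (v 0) (v 1) ∩ O).Nonempty) :
    ∃ a b : ℝ, 0 < a ∧ a < b ∧ b < 1 ∧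
      {t : ℝ | t ∈ Icc (0 : ℝ) 1 ∧ v t ∈ frontier O} = Icc a b ∧
      v a ∈ visionBoundary O (v 0) ∧ v b ∈ visionBoundary O (v 1) ∧
      (∀ t ∈ Icc 0 a, v t = AffineMap.lineMap (v 0) (v a) (t / a)) ∧
      (∀ t ∈ Icc b 1, v t = AffineMap.lineMap (v b) (v 1) ((t - b) / (1 - b))) := by
  have hfrc : ∀ t ∈ Icc (0 : ℝ) 1, (v t ∈ frontier O ↔ v t ∈ closure O) := by
    intro t ht
    rw [hO.frontier_eq, Set.mem_sdiff]
    exact and_iff_left (hv.notMem t ht)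
  set T := {t : ℝ | t ∈ Icc (0 : ℝ) 1 ∧ v t ∈ frontier O} with hT
  have hTc : IsCompact T := by
    have : IsClosed T := hv.continuousOn.preimage_isClosed_of_isClosed isClosed_Icc isClosed_frontier
    exact isCompact_Icc.of_isClosed_subset this (fun t ht => ht.1)
  -- Without contact the curve would be the segment between its end points, which meets `O`.
  have hTne : T.Nonempty := by
    by_contra hcon
    rw [not_nonempty_iff_eq_empty] at hcon
    have hchord := hv.eq_chord_of_notMem_closure le_rfl one_pos le_rfl (fun t ht hmem => by
      have : t ∈ T := ⟨ht, (hfrc t ht).2 hmem⟩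
      rw [hcon] at this
      exact this)
    obtain ⟨z, hz, hzO⟩ := hseg
    rw [segment_eq_image_lineMap] at hz
    obtain ⟨t, ht, rfl⟩ := hz
    have := hchord t ht
    rw [sub_zero, sub_zero, div_one] at this
    exact hv.notMem t ht (this ▸ hzO)
  obtain ⟨a, haT, hamin⟩ := hTc.exists_isLeast hTne
  obtain ⟨b, hbT, hbmax⟩ := hTc.exists_isGreatest hTne
  have ha0 : 0 < a := by
    rcases haT.1.1.eq_or_lt with h | h
    · exact absurd ((hfrc a haT.1).1 haT.2) (h ▸ h0)
    · exact h
  have hb1 : b < 1 := by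
    rcases hbT.1.2.eq_or_lt with h | h
    · exact absurd ((hfrc b hbT.1).1 hbT.2) (h ▸ h1)
    · exact h
  have hab : a ≤ b := hamin hbT
  have hlin : ∀ t ∈ Icc 0 a, v t = AffineMap.lineMap (v 0) (v a) (t / a) := by
    refine hv.eq_lineMap_of_Ico ha0 haT.1.2 fun t ht hmem => ?_
    have htI : t ∈ Icc (0 : ℝ) 1 := ⟨ht.1, ht.2.le.trans haT.1.2⟩
    exact absurd (hamin ⟨htI, (hfrc t htI).2 hmem⟩) (not_le.2 ht.2)
  have hlin' : ∀ t ∈ Icc 0 (1 - b), v (1 - t) = AffineMap.lineMap (v 1) (v b) (t / (1 - b)) := by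
    have := hv.reverse.eq_lineMap_of_Ico (a := 1 - b) (by linarith) (by linarith [hbT.1.1])
      (fun t ht hmem => by
        have htI : 1 - t ∈ Icc (0 : ℝ) 1 :=
          ⟨by linarith [ht.2, hbT.1.1], by linarith [ht.1]⟩
        have := hbmax ⟨htI, (hfrc _ htI).2 hmem⟩
        linarith [ht.2])
    simpa using this
  obtain ⟨ra, hra, Na, hNa⟩ := exists_isNormalField hO hconv hsm haT.2
  obtain ⟨rb, hrb, Nb, hNb⟩ := exists_isNormalField hO hconv hsm hbT.2
  -- With a single contact point, both end points would lie in the closed half-space opposite to `O`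
  -- there, and so would the segment joining them.
  have hab' : a < b := by
    refine lt_of_le_of_ne hab fun hab => ?_
    subst hab
    have h2 : 0 ≤ ⟪Na (v a), v 0 - v a⟫ := by
      refine hNa.inner_nonneg_of_segment hra haT.2 fun t ht hmem => ?_
      have hI : a * (1 - t) ∈ Icc 0 a :=
        ⟨mul_nonneg ha0.le (by linarith [ht.2]), by nlinarith [ht.1]⟩
      have h3 := hlin _ hI
      rw [mul_div_cancel_left₀ _ ha0.ne', AffineMap.lineMap_apply_module] at h3
      refine hv.notMem _ ⟨hI.1, hI.2.trans haT.1.2⟩ ?_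
      convert hmem using 1
      rw [h3]
      module
    have h3 : 0 ≤ ⟪Na (v a), v 1 - v a⟫ := by
      refine hNa.inner_nonneg_of_segment hra haT.2 fun t ht hmem => ?_
      have h1a : 0 < 1 - a := by linarith
      have hI : (1 - a) * (1 - t) ∈ Icc 0 (1 - a) :=
        ⟨mul_nonneg h1a.le (by linarith [ht.2]), by nlinarith [ht.1]⟩
      have h3 := hlin' _ hI
      rw [mul_div_cancel_left₀ _ h1a.ne', AffineMap.lineMap_apply_module] at h3
      refine hv.notMem (1 - (1 - a) * (1 - t)) ⟨by linarith [hI.2], by linarith [hI.1]⟩ ?_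
      convert hmem using 1
      rw [h3]
      module
    obtain ⟨z, ⟨α, β, hα, hβ, hαβ, rfl⟩, hzO⟩ := hseg
    have h4 := hNa.inner_neg _ (Metric.mem_ball_self hra) haT.2 _ hzO
    rw [show α • v 0 + β • v 1 - v a = α • (v 0 - v a) + β • (v 1 - v a) + (α + β - 1) • v a by
      module, hαβ, sub_self, zero_smul, add_zero, inner_add_right, real_inner_smul_right,
      real_inner_smul_right] at h4
    have := mul_nonneg hα h2
    have := mul_nonneg hβ h3
    linarith
  have hcoin : T = Icc a b := by
    refine Subset.antisymm (fun t ht => ⟨hamin ht, hbmax ht⟩) fun t ht => ?_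
    by_contra htT
    have htI : t ∈ Icc (0 : ℝ) 1 := ⟨haT.1.1.trans ht.1, ht.2.trans hbT.1.2⟩
    -- `s` and `r` bound the gap of the contact set around `t`; `exists_mem_closure` yields a
    -- contact inside it.
    obtain ⟨s, hsT, hsmax⟩ := (hTc.inter_right (isClosed_Iic (a := t))).exists_isGreatest
      ⟨a, haT, ht.1⟩
    obtain ⟨r, hrT, hrmin⟩ := (hTc.inter_right (isClosed_Ici (a := t))).exists_isLeast
      ⟨b, hbT, ht.2⟩
    have hst : s < t := lt_of_le_of_ne hsT.2 (fun h => htT (h ▸ hsT.1))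
    have htr : t < r := lt_of_le_of_ne hrT.2 (fun h => htT (h ▸ hrT.1))
    obtain ⟨τ, hτ, hmem⟩ := hv.exists_mem_closure hconv hsT.1.1.1 (hst.trans htr) hrT.1.1.2
      ((hfrc _ hsT.1.1).1 hsT.1.2) ((hfrc _ hrT.1.1).1 hrT.1.2)
    have hτI : τ ∈ Icc (0 : ℝ) 1 := ⟨hsT.1.1.1.trans hτ.1.le, hτ.2.le.trans hrT.1.1.2⟩
    have hτT : τ ∈ T := ⟨hτI, (hfrc _ hτI).2 hmem⟩
    rcases le_total τ t with h | h
    · exact absurd (hsmax ⟨hτT, h⟩) (not_le.2 hτ.1)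
    · exact absurd (hrmin ⟨hτT, h⟩) (not_le.2 hτ.2)
  have hfr : ∀ t ∈ Icc a b, v t ∈ frontier O := fun t ht => by
    rw [← hcoin] at ht
    exact ht.2
  refine ⟨a, b, ha0, hab', hb1, hcoin, ?_, ?_, hlin, ?_⟩
  · exact mem_visionBoundary haT.2 (hNa.norm_eq_one _ (Metric.mem_ball_self hra))
      (hNa.inner_neg _ (Metric.mem_ball_self hra) haT.2)
      (hv.inner_eq_zero ha0 hab' hb1.le hfr hlin hra hNa)
  · refine mem_visionBoundary hbT.2 (hNb.norm_eq_one _ (Metric.mem_ball_self hrb))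
      (hNb.inner_neg _ (Metric.mem_ball_self hrb) hbT.2) ?_
    have := hv.reverse.inner_eq_zero (a := 1 - b) (b := 1 - a) (r := rb) (N := Nb) (by linarith)
      (by linarith) (by linarith) (fun t ht => hfr _ ⟨by linarith [ht.2], by linarith [ht.1]⟩)
      (by simpa using hlin') hrb (by simpa using hNb)
    simpa using this
  · intro t ht
    have := hlin' (1 - t) ⟨by linarith [ht.2], by linarith [ht.1]⟩
    rw [sub_sub_cancel] at this
    rw [this, ← AffineMap.lineMap_apply_one_sub]
    congr 1
    have : 1 - b ≠ 0 := by linarith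
    field_simp
    ring

/-! ### Primitives, integration by parts, and the du Bois-Reymond lemma -/

section Primitive

variable {E : Type*} [NormedAddCommGroup E] [NormedSpace ℝ E]

/-- Used with `F` the integral of `‖g‖` for primitives, and with `F = u` for a Lipschitz function of
`u`. -/
theorem _root_.AbsolutelyContinuousOnInterval.of_dist_le {X Y : Type*} [PseudoMetricSpace X]
    [PseudoMetricSpace Y] {f : ℝ → X} {F : ℝ → Y} {a b K : ℝ}
    (hF : AbsolutelyContinuousOnInterval F a b)
    (h : ∀ x ∈ uIcc a b, ∀ y ∈ uIcc a b, dist (f x) (f y) ≤ K * dist (F x) (F y)) :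
    AbsolutelyContinuousOnInterval f a b := by
  have hK : Tendsto (fun E : ℕ × (ℕ → ℝ × ℝ) =>
      K * ∑ i ∈ Finset.range E.1, dist (F (E.2 i).1) (F (E.2 i).2))
      (AbsolutelyContinuousOnInterval.totalLengthFilter ⊓
        𝓟 (AbsolutelyContinuousOnInterval.disjWithin a b)) (𝓝 0) := by
    simpa using Tendsto.const_mul K hF
  refine squeeze_zero' (Eventually.of_forall fun E => Finset.sum_nonneg fun _ _ => dist_nonneg) ?_
    hK
  have : ∀ᶠ E in (AbsolutelyContinuousOnInterval.totalLengthFilter ⊓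
      𝓟 (AbsolutelyContinuousOnInterval.disjWithin a b)),
      E ∈ AbsolutelyContinuousOnInterval.disjWithin a b :=
    eventually_inf_principal.2 (by simp)
  filter_upwards [this] with E hE
  rw [Finset.mul_sum]
  exact Finset.sum_le_sum fun i hi => h _ (hE.1 i hi).1 _ (hE.1 i hi).2

/-- On `[c,d]` the function `u` is a primitive of the integrable function `g`. -/
structure IsPrimitiveOn (c d : ℝ) (u g : ℝ → E) : Prop where
  intervalIntegrable : IntervalIntegrable g volume c d
  eq_add : ∀ t ∈ Icc c d, u t = u c + ∫ s in c..t, g s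

namespace IsPrimitiveOn

variable {c d : ℝ} {u g : ℝ → E}

theorem intervalIntegrable_of_mem (h : IsPrimitiveOn c d u g) {x y : ℝ} (hx : x ∈ Icc c d)
    (hy : y ∈ Icc c d) : IntervalIntegrable g volume x y :=
  h.intervalIntegrable.mono_set (uIcc_subset_uIcc (Icc_subset_uIcc hx) (Icc_subset_uIcc hy))

theorem sub_eq (h : IsPrimitiveOn c d u g) {x y : ℝ} (hx : x ∈ Icc c d) (hy : y ∈ Icc c d) :
    u y - u x = ∫ s in x..y, g s := by
  have hc : c ∈ Icc c d := left_mem_Icc.2 (hx.1.trans hx.2)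
  rw [h.eq_add x hx, h.eq_add y hy, add_sub_add_left_eq_sub,
    intervalIntegral.integral_interval_sub_left (h.intervalIntegrable_of_mem hc hy)
      (h.intervalIntegrable_of_mem hc hx)]

theorem mono (h : IsPrimitiveOn c d u g) {x y : ℝ} (hx : c ≤ x) (hxy : x ≤ y) (hy : y ≤ d) :
    IsPrimitiveOn x y u g where
  intervalIntegrable := h.intervalIntegrable_of_mem ⟨hx, hxy.trans hy⟩ ⟨hx.trans hxy, hy⟩
  eq_add t ht := by
    rw [← h.sub_eq ⟨hx, hxy.trans hy⟩ ⟨hx.trans ht.1, ht.2.trans hy⟩, add_sub_cancel]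

theorem absolutelyContinuousOnInterval (h : IsPrimitiveOn c d u g) (hcd : c ≤ d) :
    AbsolutelyContinuousOnInterval u c d := by
  have hc : c ∈ Icc c d := left_mem_Icc.2 hcd
  refine (h.intervalIntegrable.norm.absolutelyContinuousOnInterval_intervalIntegral
    left_mem_uIcc).of_dist_le (K := 1) fun x hx y hy => ?_
  rw [uIcc_of_le hcd] at hx hy
  rw [one_mul, dist_comm, dist_eq_norm, h.sub_eq hx hy, dist_comm, Real.dist_eq,
    intervalIntegral.integral_interval_sub_left (h.intervalIntegrable_of_mem hc hy).norm
      (h.intervalIntegrable_of_mem hc hx).norm]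
  exact intervalIntegral.norm_integral_le_abs_integral_norm

theorem continuousOn (h : IsPrimitiveOn c d u g) (hcd : c ≤ d) : ContinuousOn u (Icc c d) := by
  rw [← uIcc_of_le hcd]
  exact (h.absolutelyContinuousOnInterval hcd).continuousOn

theorem ae_hasDerivAt [CompleteSpace E] (h : IsPrimitiveOn c d u g) :
    ∀ᵐ t, t ∈ Ioo c d → HasDerivAt u (g t) t := by
  filter_upwards [h.intervalIntegrable.ae_hasDerivAt_integral] with t ht htI
  have h1 := (ht (Icc_subset_uIcc (Ioo_subset_Icc_self htI)) c left_mem_uIcc).const_add (u c)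
  refine h1.congr_of_eventuallyEq ?_
  filter_upwards [Ioo_mem_nhds htI.1 htI.2] with s hs
  exact h.eq_add s (Ioo_subset_Icc_self hs)

/-- The difference with the integral of `g` is absolutely continuous with zero derivative almost
everywhere, hence constant; the two end points are a null set. -/
theorem of_absolutelyContinuousOnInterval [CompleteSpace E] (hcd : c ≤ d)
    (hu : AbsolutelyContinuousOnInterval u c d)
    (hg : IntervalIntegrable g volume c d) (h : ∀ᵐ t, t ∈ Ioo c d → HasDerivAt u (g t) t) :
    IsPrimitiveOn c d u g := by
  refine ⟨hg, ?_⟩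
  set G : ℝ → E := fun t => u c + ∫ s in c..t, g s
  have hG : IsPrimitiveOn c d G g := ⟨hg, fun t _ => by simp [G]⟩
  have h0 : ∀ᵐ t, t ∈ uIcc c d → HasDerivAt (fun t => u t - G t) 0 t := by
    have hc : ∀ᵐ t : ℝ, t ≠ c := by simp [ae_iff, measure_singleton]
    have hd : ∀ᵐ t : ℝ, t ≠ d := by simp [ae_iff, measure_singleton]
    filter_upwards [h, hG.ae_hasDerivAt, hc, hd] with t h1 h2 h3 h4 ht
    rw [uIcc_of_le hcd] at ht
    have ht' : t ∈ Ioo c d := ⟨lt_of_le_of_ne ht.1 h3.symm, lt_of_le_of_ne ht.2 h4⟩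
    simpa using (h1 ht').fun_sub (h2 ht')
  obtain ⟨C, hC⟩ :=
    (hu.fun_sub (hG.absolutelyContinuousOnInterval hcd)).const_of_ae_hasDerivAt_zero h0
  rw [uIcc_of_le hcd] at hC
  intro t ht
  have h1 := hC t ht
  have h2 := hC c (left_mem_Icc.2 hcd)
  have h3 : G c = u c := by simp [G]
  rw [h3, sub_self] at h2
  rw [← h2, sub_eq_zero] at h1
  exact h1

theorem of_hasDerivAt [CompleteSpace E] (hu : ∀ t, HasDerivAt u (g t) t)
    (hg : Continuous g) : IsPrimitiveOn c d u g where
  intervalIntegrable := hg.intervalIntegrable _ _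
  eq_add t _ := by
    rw [intervalIntegral.integral_eq_sub_of_hasDerivAt (fun s _ => hu s)
      (hg.intervalIntegrable _ _), add_sub_cancel]

theorem add {v k : ℝ → E} (h : IsPrimitiveOn c d u g) (h' : IsPrimitiveOn c d v k) :
    IsPrimitiveOn c d (fun t => u t + v t) (fun t => g t + k t) where
  intervalIntegrable := h.intervalIntegrable.add h'.intervalIntegrable
  eq_add t ht := by
    have hc : c ∈ Icc c d := left_mem_Icc.2 (ht.1.trans ht.2)
    rw [h.eq_add t ht, h'.eq_add t ht, intervalIntegral.integral_add
      (h.intervalIntegrable_of_mem hc ht) (h'.intervalIntegrable_of_mem hc ht)]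
    abel

theorem const_smul (h : IsPrimitiveOn c d u g) (r : ℝ) :
    IsPrimitiveOn c d (fun t => r • u t) (fun t => r • g t) where
  intervalIntegrable := h.intervalIntegrable.smul r
  eq_add t ht := by
    rw [h.eq_add t ht, intervalIntegral.integral_smul, smul_add]

/-- Integration by parts against test functions. -/
theorem integral_deriv_smul [CompleteSpace E] (h : IsPrimitiveOn c d u g) (hcd : c ≤ d)
    {ψ : ℝ → ℝ} (hψ : ContDiff ℝ ∞ ψ) (hsupp : tsupport ψ ⊆ Ioo c d) :
    ∫ t in Ioo c d, deriv ψ t • u t = - ∫ t in Ioo c d, ψ t • g t := by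
  have hψd : Differentiable ℝ ψ := hψ.differentiable (by simp)
  have hψ' : Continuous (deriv ψ) := hψ.continuous_deriv (by simp)
  have huc := h.continuousOn hcd
  have i1 : IntervalIntegrable (fun t => deriv ψ t • u t) volume c d := by
    apply ContinuousOn.intervalIntegrable
    rw [uIcc_of_le hcd]
    exact hψ'.continuousOn.smul huc
  have i2 : IntervalIntegrable (fun t => ψ t • g t) volume c d :=
    h.intervalIntegrable.continuousOn_smul hψ.continuous.continuousOn
  have hac : AbsolutelyContinuousOnInterval ψ c d :=
    (hψ.of_le (by simp)).contDiffOn.absolutelyContinuousOnInterval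
  have hprim : IsPrimitiveOn c d (fun t => ψ t • u t) (fun t => deriv ψ t • u t + ψ t • g t) := by
    refine of_absolutelyContinuousOnInterval hcd
      (hac.fun_smul (h.absolutelyContinuousOnInterval hcd)) (i1.add i2) ?_
    filter_upwards [h.ae_hasDerivAt] with t ht htI
    rw [add_comm]
    exact (hψd t).hasDerivAt.smul (ht htI)
  have hz : ∀ t, t ∉ Ioo c d → ψ t = 0 := fun t ht => by
    by_contra h0
    exact ht (hsupp (subset_tsupport ψ h0))
  have h0 := hprim.sub_eq (left_mem_Icc.2 hcd) (right_mem_Icc.2 hcd)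
  simp only [hz c (by simp), hz d (by simp), zero_smul, sub_self] at h0
  rw [intervalIntegral.integral_add i1 i2] at h0
  simp only [← integral_Ioc_eq_integral_Ioo, ← intervalIntegral.integral_of_le hcd]
  exact eq_neg_of_add_eq_zero_left h0.symm

end IsPrimitiveOn

/-- The lemma of du Bois-Reymond. -/
theorem ae_eq_const_of_integral_deriv_smul_eq_zero [CompleteSpace E] {c d : ℝ} (hcd : c < d)
    {f : ℝ → E} (hf : IntegrableOn f (Ioo c d))
    (h : ∀ ψ : ℝ → ℝ, ContDiff ℝ ∞ ψ → HasCompactSupport ψ → tsupport ψ ⊆ Ioo c d →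
      ∫ t in Ioo c d, deriv ψ t • f t = 0) :
    ∃ C : E, ∀ᵐ t, t ∈ Ioo c d → f t = C := by
  obtain ⟨χ, hχs, hχc, hχ, hχr, hχm⟩ := exists_contDiff_tsupport_subset (E := ℝ) (n := ⊤)
    (Ioo_mem_nhds (a := c) (b := d) (x := (c + d) / 2) (by linarith) (by linarith))
  have hχ : ContDiff ℝ ∞ χ := hχ
  have iφ : ∀ {φ : ℝ → ℝ}, Continuous φ → HasCompactSupport φ →
      IntegrableOn (fun t => φ t • f t) (Ioo c d) := by
    intro φ hφ hφc
    obtain ⟨B, hB⟩ := hφc.exists_bound_of_continuous hφ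
    exact hf.bdd_smul B hφ.aestronglyMeasurable (Eventually.of_forall hB)
  have hfull : ∀ {φ : ℝ → ℝ} (k : ℝ → E), tsupport φ ⊆ Ioo c d →
      ∫ t, φ t • k t = ∫ t in Ioo c d, φ t • k t := by
    intro φ k hs
    symm
    apply setIntegral_eq_integral_of_forall_compl_eq_zero
    intro t ht
    have : φ t = 0 := by
      by_contra h0
      exact ht (hs (subset_tsupport φ h0))
    simp [this]
  have hχ0 : ∀ t, 0 ≤ χ t := fun t => (hχr (mem_range_self t)).1
  set A := ∫ t, χ t with hA
  have hApos : 0 < A := by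
    rw [hA, integral_pos_iff_support_of_nonneg hχ0 (hχ.continuous.integrable_of_hasCompactSupport hχc)]
    have : IsOpen (Function.support χ) := hχ.continuous.isOpen_support
    exact this.measure_pos _ ⟨(c + d) / 2, by simp [hχm]⟩
  set C : E := A⁻¹ • ∫ t in Ioo c d, χ t • f t with hC
  refine ⟨C, ?_⟩
  have key := IsOpen.ae_eq_zero_of_integral_contDiff_smul_eq_zero (μ := (volume : Measure ℝ))
    (f := fun t => f t - C) (isOpen_Ioo (a := c) (b := d))
    ((hf.sub (integrableOn_const (by simp))).locallyIntegrableOn) (by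
      intro φ hφ hφc hφs
      -- Subtracting a multiple of the bump `χ` gives `η` integral zero, so its primitive `ψ` has
      -- compact support in `(c,d)` and is an allowed test function.
      set η : ℝ → ℝ := fun t => φ t - ((∫ t, φ t) / A) * χ t with hη
      have hηd : ContDiff ℝ ∞ η := hφ.sub (contDiff_const.mul hχ)
      have iφ0 := hφ.continuous.integrable_of_hasCompactSupport (μ := volume) hφc
      have iχ0 := hχ.continuous.integrable_of_hasCompactSupport (μ := volume) hχc
      have hηint : ∫ t, η t = 0 := by
        simp only [hη]
        rw [integral_sub iφ0 (iχ0.const_mul _), integral_const_mul, ← hA]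
        field_simp
        ring
      set K := tsupport φ ∪ tsupport χ with hK
      have hKc : IsCompact K := hφc.isCompact.union hχc.isCompact
      have hKne : K.Nonempty := ⟨(c + d) / 2, Or.inr (subset_tsupport _ (by simp [hχm]))⟩
      have hKs : K ⊆ Ioo c d := union_subset hφs hχs
      obtain ⟨c', hc'K, hc'⟩ := hKc.exists_isLeast hKne
      obtain ⟨d', hd'K, hd'⟩ := hKc.exists_isGreatest hKne
      have hη0 : ∀ t, t ∉ Icc c' d' → η t = 0 := by
        intro t ht
        have htK : t ∉ K := fun hK' => ht ⟨hc' hK', hd' hK'⟩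
        have h1 : φ t = 0 := by
          by_contra h0
          exact htK (Or.inl (subset_tsupport _ h0))
        have h2 : χ t = 0 := by
          by_contra h0
          exact htK (Or.inr (subset_tsupport _ h0))
        simp [hη, h1, h2]
      set ψ : ℝ → ℝ := fun x => ∫ t in c..x, η t with hψ
      have hψd : ∀ x, HasDerivAt ψ (η x) x := fun x =>
        intervalIntegral.integral_hasDerivAt_right (hηd.continuous.intervalIntegrable _ _)
          hηd.continuous.stronglyMeasurable.stronglyMeasurableAtFilter hηd.continuous.continuousAt
      have hψderiv : deriv ψ = η := funext fun x => (hψd x).deriv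
      have hψC : ContDiff ℝ ∞ ψ :=
        contDiff_infty_iff_deriv.2 ⟨fun x => (hψd x).differentiableAt, hψderiv ▸ hηd⟩
      have hψ0 : ∀ x, x ∉ Icc c' d' → ψ x = 0 := by
        intro x hx
        by_cases hxc : x < c'
        · simp only [hψ]
          apply intervalIntegral.integral_zero_ae
          refine Eventually.of_forall fun t ht => hη0 t fun htI => ?_
          have : t ≤ max c x := ht.2
          exact absurd (htI.1.trans this) (not_le.2 (max_lt (hKs hc'K).1 hxc))
        · have hdx : d' < x := by
            by_contra hcon
            exact hx ⟨not_lt.1 hxc, not_lt.1 hcon⟩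
          simp only [hψ]
          rw [intervalIntegral.integral_eq_integral_of_support_subset, hηint]
          intro t ht
          have : t ∈ Icc c' d' := by
            by_contra hcon
            exact ht (hη0 t hcon)
          exact ⟨(hKs hc'K).1.trans_le this.1, this.2.trans hdx.le⟩
      have hψs : tsupport ψ ⊆ Icc c' d' := by
        apply closure_minimal _ isClosed_Icc
        intro x hx
        by_contra hcon
        exact hx (hψ0 x hcon)
      have h0 := h ψ hψC (isCompact_Icc.of_isClosed_subset (isClosed_tsupport ψ) hψs)
        (hψs.trans fun x hx => ⟨(hKs hc'K).1.trans_le hx.1, hx.2.trans_lt (hKs hd'K).2⟩)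
      rw [hψderiv] at h0
      have h1 : ∫ t in Ioo c d, φ t • f t = ((∫ t, φ t) / A) • ∫ t in Ioo c d, χ t • f t := by
        simp only [hη, sub_smul, mul_smul] at h0
        rw [integral_sub (iφ hφ.continuous hφc) (Integrable.fun_smul _ (iφ hχ.continuous hχc)),
          integral_smul, sub_eq_zero] at h0
        exact h0
      rw [hfull _ hφs]
      simp only [smul_sub]
      rw [integral_sub (iφ hφ.continuous hφc) (iφ0.integrableOn.smul_const C), h1,
        ← hfull _ hφs, integral_smul_const, hC, smul_smul, div_eq_mul_inv, sub_self])
  filter_upwards [key] with t ht hmem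
  exact sub_eq_zero.1 (ht hmem)

end Primitive

/-! ### Continuous `H¹` curves and their energy -/

section Sobolev

variable {n : ℕ} {u g : ℝ → Rn n}

theorem memLp_Ioc_iff {E : Type*} [NormedAddCommGroup E] {f : ℝ → E} {c d : ℝ} :
    MemLp f 2 (volume.restrict (Ioc c d)) ↔ MemLp f 2 (volume.restrict (Ioo c d)) := by
  rw [restrict_Ioo_eq_restrict_Ioc]

theorem _root_.MeasureTheory.MemLp.intervalIntegrable_Ioo {E : Type*} [NormedAddCommGroup E]
    {f : ℝ → E} {c d : ℝ}
    (hf : MemLp f 2 (volume.restrict (Ioo c d))) (hcd : c ≤ d) :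
    IntervalIntegrable f volume c d := by
  rw [intervalIntegrable_iff_integrableOn_Ioo_of_le hcd]
  exact hf.integrable (by norm_num)

theorem _root_.MeasureTheory.MemLp.intervalIntegrable_norm_sq {E : Type*} [NormedAddCommGroup E]
    {f : ℝ → E} {c d : ℝ}
    (hf : MemLp f 2 (volume.restrict (Ioo c d))) (hcd : c ≤ d) :
    IntervalIntegrable (fun t => ‖f t‖ ^ 2) volume c d := by
  rw [intervalIntegrable_iff_integrableOn_Ioo_of_le hcd]
  exact (memLp_two_iff_integrable_sq_norm hf.1).1 hf

theorem energy_eq_intervalIntegral (u : ℝ → Rn n) :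
    energy u = ∫ t in (0 : ℝ)..1, ‖weakDeriv u t‖ ^ 2 := by
  rw [energy, intervalIntegral.integral_of_le zero_le_one, integral_Ioc_eq_integral_Ioo]

theorem IsPrimitiveOn.hasWeakDeriv (h : IsPrimitiveOn 0 1 u g) : HasWeakDeriv u g :=
  fun _ hφ _ hs => h.integral_deriv_smul zero_le_one hφ hs

theorem IsPrimitiveOn.memH1 (h : IsPrimitiveOn 0 1 u g)
    (hg : MemLp g 2 (volume.restrict (Ioo (0 : ℝ) 1))) : MemH1 u := by
  refine ⟨?_, g, hg, h.hasWeakDeriv⟩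
  rw [← memLp_Ioc_iff]
  have hc := h.continuousOn zero_le_one
  obtain ⟨B, hB⟩ := isCompact_Icc.exists_bound_of_continuousOn hc
  have : MemLp u 2 (volume.restrict (Icc (0 : ℝ) 1)) :=
    MemLp.of_bound (hc.aestronglyMeasurable measurableSet_Icc) B
      ((ae_restrict_iff' measurableSet_Icc).2 (Eventually.of_forall hB))
  exact this.mono_measure (Measure.restrict_mono Ioc_subset_Icc_self le_rfl)

theorem IsPrimitiveOn.energy_eq (h : IsPrimitiveOn 0 1 u g)
    (hg : MemLp g 2 (volume.restrict (Ioo (0 : ℝ) 1))) :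
    energy u = ∫ t in (0 : ℝ)..1, ‖g t‖ ^ 2 := by
  rw [energy, intervalIntegral.integral_of_le zero_le_one, integral_Ioc_eq_integral_Ioo]
  refine integral_congr_ae ?_
  filter_upwards [weakDeriv_ae_eq hg h.hasWeakDeriv] with t ht
  rw [ht]

theorem MemH1.weakDeriv_spec (h : MemH1 u) :
    MemLp (weakDeriv u) 2 (volume.restrict (Ioo (0 : ℝ) 1)) ∧ HasWeakDeriv u (weakDeriv u) := by
  unfold weakDeriv
  rw [dif_pos h.2]
  exact h.2.choose_spec

/-- A continuous `H¹` function is a primitive of its weak derivative. -/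
theorem MemH1.isPrimitiveOn (h : MemH1 u) (hc : ContinuousOn u (Icc 0 1)) :
    IsPrimitiveOn 0 1 u (weakDeriv u) := by
  obtain ⟨hg, hw⟩ := h.weakDeriv_spec
  set g := weakDeriv u
  have hgi := hg.intervalIntegrable_Ioo zero_le_one
  set G : ℝ → Rn n := fun t => ∫ s in (0 : ℝ)..t, g s
  have hG : IsPrimitiveOn 0 1 G g := ⟨hgi, fun t _ => by simp [G]⟩
  have hGc := hG.continuousOn zero_le_one
  have hi : ∀ {f : ℝ → Rn n}, ContinuousOn f (Icc 0 1) → IntegrableOn f (Ioo 0 1) := fun hf =>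
    (hf.integrableOn_compact isCompact_Icc).mono_set Ioo_subset_Icc_self
  -- `u - G` has zero weak derivative, so it is almost everywhere constant; continuity makes this
  -- hold at every point of `[0,1]`.
  obtain ⟨C, hC⟩ := ae_eq_const_of_integral_deriv_smul_eq_zero zero_lt_one
    (f := fun t => u t - G t) (hi (hc.sub hGc)) (by
      intro ψ hψ hψc hψs
      have hψ' : Continuous (deriv ψ) := hψ.continuous_deriv (by simp)
      simp only [smul_sub]
      rw [integral_sub (hi (hψ'.continuousOn.fun_smul hc)) (hi (hψ'.continuousOn.fun_smul hGc)),
        hw ψ hψ hψc hψs, hG.hasWeakDeriv ψ hψ hψc hψs, sub_self])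
  have hEq : EqOn (fun t => u t - G t) (fun _ => C) (Icc 0 1) := by
    refine Measure.eqOn_Icc_of_ae_eq volume zero_ne_one ?_ (hc.sub hGc) continuousOn_const
    rw [← restrict_Ioo_eq_restrict_Icc]
    exact (ae_restrict_iff' measurableSet_Ioo).2 hC
  refine ⟨hgi, fun t ht => ?_⟩
  have h1 : u t - G t = C := hEq ht
  have h2 : u 0 - G 0 = C := hEq (left_mem_Icc.2 zero_le_one)
  have h3 : G 0 = 0 := by simp [G]
  rw [h3, sub_zero] at h2
  rw [h2, ← h1, sub_add_cancel]

end Sobolev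

/-! ### Gluing competitors; minimizers are taut -/

namespace IsEnergyMinimizer

variable {n : ℕ} {O : Set (Rn n)} {p q : Rn n} {u : ℝ → Rn n}

theorem memLp (hu : IsEnergyMinimizer O p q u) :
    MemLp (weakDeriv u) 2 (volume.restrict (Ioo (0 : ℝ) 1)) :=
  hu.1.1.weakDeriv_spec.1

theorem memLp_of_le (hu : IsEnergyMinimizer O p q u) {c d : ℝ} (hc : 0 ≤ c) (hd : d ≤ 1) :
    MemLp (weakDeriv u) 2 (volume.restrict (Ioo c d)) :=
  hu.memLp.mono_measure (Measure.restrict_mono (Ioo_subset_Ioo hc hd) le_rfl)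

theorem isPrimitiveOn (hu : IsEnergyMinimizer O p q u) : IsPrimitiveOn 0 1 u (weakDeriv u) :=
  hu.1.1.isPrimitiveOn hu.1.2.1

/-- A minimizer of the energy minimizes it on every subinterval. -/
theorem integral_norm_sq_le (hu : IsEnergyMinimizer O p q u) {c d : ℝ} (hc : 0 ≤ c) (hcd : c ≤ d)
    (hd : d ≤ 1) {σ k : ℝ → Rn n} (hσ : IsPrimitiveOn c d σ k)
    (hk : MemLp k 2 (volume.restrict (Ioo c d))) (hσc : σ c = u c) (hσd : σ d = u d)
    (hO : ∀ t ∈ Icc c d, σ t ∉ O) :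
    ∫ t in c..d, ‖weakDeriv u t‖ ^ 2 ≤ ∫ t in c..d, ‖k t‖ ^ 2 := by
  classical
  set g := weakDeriv u with hgdef
  have hprim := hu.isPrimitiveOn
  have hI0 : (0 : ℝ) ∈ Icc (0 : ℝ) 1 := by simp
  have hI1 : (1 : ℝ) ∈ Icc (0 : ℝ) 1 := by simp
  have hIc : c ∈ Icc (0 : ℝ) 1 := ⟨hc, hcd.trans hd⟩
  have hId : d ∈ Icc (0 : ℝ) 1 := ⟨hc.trans hcd, hd⟩
  set v : ℝ → Rn n := (Icc c d).piecewise σ u with hv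
  -- `Ioc` matches the domain of the interval integral, so `k'` equals `g` or `k` at every point of
  -- each of the three pieces.
  set k' : ℝ → Rn n := (Ioc c d).piecewise k g with hk'
  have hkL : MemLp k' 2 (volume.restrict (Ioo (0 : ℝ) 1)) := by
    refine MemLp.piecewise measurableSet_Ioc ?_ ?_
    · rw [Measure.restrict_restrict measurableSet_Ioc]
      exact (memLp_Ioc_iff.2 hk).mono_measure (Measure.restrict_mono inter_subset_left le_rfl)
    · rw [Measure.restrict_restrict measurableSet_Ioc.compl]
      exact hu.memLp.mono_measure (Measure.restrict_mono inter_subset_right le_rfl)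
  have hk'i := hkL.intervalIntegrable_Ioo zero_le_one
  have e1 : ∀ x ≤ c, ∀ t ∈ uIoc 0 x, x ∈ Icc (0 : ℝ) 1 → k' t = g t := by
    intro x hx t ht hxI
    rw [uIoc_of_le hxI.1] at ht
    exact piecewise_eq_of_notMem _ _ _ fun h => absurd h.1 (not_lt.2 (ht.2.trans hx))
  have e2 : ∀ x ∈ Icc c d, ∀ t ∈ uIoc c x, k' t = k t := by
    intro x hx t ht
    rw [uIoc_of_le hx.1] at ht
    exact piecewise_eq_of_mem _ _ _ ⟨ht.1, ht.2.trans hx.2⟩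
  have e3 : ∀ x ∈ Icc d 1, ∀ t ∈ uIoc d x, k' t = g t := by
    intro x hx t ht
    rw [uIoc_of_le hx.1] at ht
    exact piecewise_eq_of_notMem _ _ _ fun h => absurd h.2 (not_le.2 ht.1)
  have hsubi : ∀ {x y}, x ∈ Icc (0 : ℝ) 1 → y ∈ Icc (0 : ℝ) 1 →
      IntervalIntegrable k' volume x y := fun hx hy =>
    hk'i.mono_set (uIcc_subset_uIcc (Icc_subset_uIcc hx) (Icc_subset_uIcc hy))
  have j1 : ∀ x ∈ Icc 0 c, u 0 + ∫ s in (0 : ℝ)..x, k' s = u x := by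
    intro x hx
    have hxI : x ∈ Icc (0 : ℝ) 1 := ⟨hx.1, hx.2.trans hIc.2⟩
    rw [intervalIntegral.integral_congr_ae
      (Eventually.of_forall fun t ht => e1 x hx.2 t ht hxI), ← hprim.eq_add x hxI]
  have j2 : ∀ x ∈ Icc c d, u 0 + ∫ s in (0 : ℝ)..x, k' s = σ x := by
    intro x hx
    have hxI : x ∈ Icc (0 : ℝ) 1 := ⟨hc.trans hx.1, hx.2.trans hd⟩
    rw [← intervalIntegral.integral_add_adjacent_intervals (hsubi hI0 hIc) (hsubi hIc hxI),
      ← add_assoc, j1 c ⟨hc, le_rfl⟩, intervalIntegral.integral_congr_ae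
      (Eventually.of_forall fun t ht => e2 x hx t ht), hσ.eq_add x hx, hσc]
  have j3 : ∀ x ∈ Icc d 1, u 0 + ∫ s in (0 : ℝ)..x, k' s = u x := by
    intro x hx
    have hxI : x ∈ Icc (0 : ℝ) 1 := ⟨hId.1.trans hx.1, hx.2⟩
    rw [← intervalIntegral.integral_add_adjacent_intervals (hsubi hI0 hId) (hsubi hId hxI),
      ← add_assoc, j2 d ⟨hcd, le_rfl⟩, intervalIntegral.integral_congr_ae
      (Eventually.of_forall fun t ht => e3 x hx t ht), hσd, ← hprim.sub_eq hId hxI,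
      add_sub_cancel]
  have hvσ : ∀ x ∈ Icc c d, v x = σ x := fun x hx => piecewise_eq_of_mem _ _ _ hx
  have hvu : ∀ x ∉ Icc c d, v x = u x := fun x hx => piecewise_eq_of_notMem _ _ _ hx
  have hv0 : v 0 = u 0 := by
    by_cases h : (0 : ℝ) ∈ Icc c d
    · have : c = 0 := le_antisymm h.1 hc
      rw [hvσ _ h, ← this, hσc]
    · exact hvu _ h
  have hv1 : v 1 = u 1 := by
    by_cases h : (1 : ℝ) ∈ Icc c d
    · have : d = 1 := le_antisymm hd h.2
      rw [hvσ _ h, ← this, hσd]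
    · exact hvu _ h
  have hvprim : IsPrimitiveOn 0 1 v k' := by
    refine ⟨hk'i, fun t ht => ?_⟩
    rw [hv0]
    by_cases h : t ∈ Icc c d
    · rw [hvσ t h, j2 t h]
    · rw [hvu t h]
      rcases lt_or_ge t c with h1 | h1
      · exact (j1 t ⟨ht.1, h1.le⟩).symm
      · exact (j3 t ⟨(not_le.1 fun h2 => h ⟨h1, h2⟩).le, ht.2⟩).symm
  have hvadm : v ∈ admissible O p q := by
    refine ⟨hvprim.memH1 hkL, hvprim.continuousOn zero_le_one, hv0.trans hu.1.2.2.1,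
      hv1.trans hu.1.2.2.2.1, fun t ht => ?_⟩
    by_cases h : t ∈ Icc c d
    · rw [hvσ t h]
      exact hO t h
    · rw [hvu t h]
      exact hu.1.2.2.2.2 t ht
  have hE := hu.2 v hvadm
  rw [energy_eq_intervalIntegral, hvprim.energy_eq hkL] at hE
  have hsq : ∀ {f : ℝ → Rn n}, MemLp f 2 (volume.restrict (Ioo (0 : ℝ) 1)) →
      ∫ t in (0 : ℝ)..1, ‖f t‖ ^ 2 = (∫ t in (0 : ℝ)..c, ‖f t‖ ^ 2) +
        (∫ t in c..d, ‖f t‖ ^ 2) + ∫ t in d..1, ‖f t‖ ^ 2 := by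
    intro f hf
    have hfi := hf.intervalIntegrable_norm_sq zero_le_one
    have hfs : ∀ {x y}, x ∈ Icc (0 : ℝ) 1 → y ∈ Icc (0 : ℝ) 1 →
        IntervalIntegrable (fun t => ‖f t‖ ^ 2) volume x y := fun hx hy =>
      hfi.mono_set (uIcc_subset_uIcc (Icc_subset_uIcc hx) (Icc_subset_uIcc hy))
    rw [intervalIntegral.integral_add_adjacent_intervals (hfs hI0 hIc) (hfs hIc hId),
      intervalIntegral.integral_add_adjacent_intervals (hfs hI0 hId) (hfs hId hI1)]
  rw [hsq hkL, hsq hu.memLp] at hE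
  have f1 : ∫ t in (0 : ℝ)..c, ‖k' t‖ ^ 2 = ∫ t in (0 : ℝ)..c, ‖g t‖ ^ 2 :=
    intervalIntegral.integral_congr_ae (Eventually.of_forall fun t ht => by
      simp only [e1 c le_rfl t ht hIc])
  have f2 : ∫ t in c..d, ‖k' t‖ ^ 2 = ∫ t in c..d, ‖k t‖ ^ 2 :=
    intervalIntegral.integral_congr_ae (Eventually.of_forall fun t ht => by
      simp only [e2 d ⟨hcd, le_rfl⟩ t ht])
  have f3 : ∫ t in d..1, ‖k' t‖ ^ 2 = ∫ t in d..1, ‖g t‖ ^ 2 :=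
    intervalIntegral.integral_congr_ae (Eventually.of_forall fun t ht => by
      simp only [e3 1 ⟨hd, le_rfl⟩ t ht])
  rw [f1, f2, f3] at hE
  linarith

/-- On `[c,d]` the energies of `u` and of the competitor are `(d-c)‖m‖² + s²R` with `s = 1` and `s =
1 - ε`. Since `(1 - ε)² < 1`, minimality forces `R = 0`, that is, `u' = m` almost everywhere. -/
theorem isTaut (hu : IsEnergyMinimizer O p q u) : IsTaut O u where
  continuousOn := hu.1.2.1
  notMem := hu.1.2.2.2.2
  eq_chord c d ε hc hcd hd hε hε1 hO := by
    set g := weakDeriv u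
    have hprim : IsPrimitiveOn c d u g := hu.isPrimitiveOn.mono hc hcd.le hd
    have hgL : MemLp g 2 (volume.restrict (Ioo c d)) := hu.memLp_of_le hc hd
    have hdc : d - c ≠ 0 := by linarith
    set m : Rn n := (d - c)⁻¹ • (u d - u c) with hm
    set ℓ : ℝ → Rn n := fun t => AffineMap.lineMap (u c) (u d) ((t - c) / (d - c)) with hℓ
    have hℓ' : ∀ t, ℓ t = (t - c) • m + u c := by
      intro t
      simp only [hℓ, hm, AffineMap.lineMap_apply_module', smul_smul, div_eq_mul_inv]
    have hℓprim : IsPrimitiveOn c d ℓ (fun _ => m) := by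
      refine IsPrimitiveOn.of_hasDerivAt (fun t => ?_) continuous_const
      rw [funext hℓ']
      simpa using (((hasDerivAt_id t).sub_const c).smul_const m).add_const (u c)
    have hmin := hu.integral_norm_sq_le hc hcd.le hd
      ((hprim.const_smul (1 - ε)).add (hℓprim.const_smul ε))
      ((hgL.const_smul (1 - ε)).add ((memLp_const m).const_smul ε))
      (by simp only [hℓ']; module) (by
        have : ℓ d = u d := by simp [hℓ, div_self hdc]
        rw [this]; module) hO
    have hrL : MemLp (fun t => g t - m) 2 (volume.restrict (Ioo c d)) := hgL.sub (memLp_const m)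
    have hri := hrL.intervalIntegrable_Ioo hcd.le
    have hrsq := hrL.intervalIntegrable_norm_sq hcd.le
    have hr0 : ∫ t in c..d, (g t - m) = 0 := by
      rw [intervalIntegral.integral_sub hprim.intervalIntegrable intervalIntegrable_const,
        intervalIntegral.integral_const, ← hprim.sub_eq (left_mem_Icc.2 hcd.le)
        (right_mem_Icc.2 hcd.le), hm, smul_smul, mul_inv_cancel₀ hdc, one_smul, sub_self]
    have hin : ∫ t in c..d, inner ℝ m (g t - m) = 0 := by
      rw [intervalIntegral.integral_of_le hcd.le] at hr0 ⊢
      rw [integral_inner ((intervalIntegrable_iff_integrableOn_Ioc_of_le hcd.le).1 hri), hr0,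
        inner_zero_right]
    have hini : IntervalIntegrable (fun t => inner ℝ m (g t - m)) volume c d := by
      rw [intervalIntegrable_iff_integrableOn_Ioc_of_le hcd.le] at hri ⊢
      exact Integrable.const_inner m hri
    have hexp : ∀ s : ℝ, ∫ t in c..d, ‖m + s • (g t - m)‖ ^ 2 =
        (d - c) * ‖m‖ ^ 2 + s ^ 2 * ∫ t in c..d, ‖g t - m‖ ^ 2 := by
      intro s
      have : ∀ t, ‖m + s • (g t - m)‖ ^ 2 =
          ‖m‖ ^ 2 + (2 * s) * inner ℝ m (g t - m) + s ^ 2 * ‖g t - m‖ ^ 2 := by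
        intro t
        rw [norm_add_sq_real, real_inner_smul_right, norm_smul s, mul_pow, Real.norm_eq_abs, sq_abs]
        ring
      simp only [this]
      rw [intervalIntegral.integral_add (intervalIntegrable_const.add (hini.const_mul _))
        (hrsq.const_mul _), intervalIntegral.integral_add intervalIntegrable_const
        (hini.const_mul _), intervalIntegral.integral_const_mul,
        intervalIntegral.integral_const_mul, hin, intervalIntegral.integral_const, smul_eq_mul]
      ring
    have h1 := hexp 1
    have h2 := hexp (1 - ε)
    have h3 : ∀ t, m + (1 : ℝ) • (g t - m) = g t := fun t => by module
    have h4 : ∀ t, m + (1 - ε) • (g t - m) = (1 - ε) • g t + ε • m := fun t => by module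
    simp only [h3] at h1
    simp only [h4] at h2
    rw [h1, h2] at hmin
    set R := ∫ t in c..d, ‖g t - m‖ ^ 2 with hR
    have hR0 : 0 ≤ R := intervalIntegral.integral_nonneg hcd.le fun t _ => by positivity
    have hR0' : R = 0 := by
      by_contra hne
      have : 0 < R := lt_of_le_of_ne hR0 (Ne.symm hne)
      have h5 : (1 - ε) ^ 2 < 1 := by nlinarith
      nlinarith
    rw [hR, intervalIntegral.integral_of_le hcd.le, integral_eq_zero_iff_of_nonneg
      (fun t => by positivity)
      ((intervalIntegrable_iff_integrableOn_Ioc_of_le hcd.le).1 hrsq)] at hR0'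
    intro t ht
    have : ∫ s in c..t, g s = ∫ s in c..t, m := by
      refine intervalIntegral.integral_congr_ae ?_
      filter_upwards [(ae_restrict_iff' measurableSet_Ioc).1 hR0'] with s hs hst
      rw [uIoc_of_le ht.1] at hst
      have := hs ⟨hst.1, hst.2.trans ht.2⟩
      simp only [Pi.zero_apply, ne_eq, OfNat.ofNat_ne_zero, not_false_eq_true,
        pow_eq_zero_iff, norm_eq_zero] at this
      exact sub_eq_zero.1 this
    change u t = ℓ t
    rw [hprim.eq_add t ht, this, intervalIntegral.integral_const, hℓ']
    abel

end IsEnergyMinimizer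

/-! ### First variation of a quadratic functional -/

section FirstVariation

variable {α E : Type*} [MeasurableSpace α] {μ : Measure α} [NormedAddCommGroup E]
  [InnerProductSpace ℝ E] {f w : α → E}

theorem _root_.MeasureTheory.MemLp.integrable_real_inner (hf : MemLp f 2 μ) (hw : MemLp w 2 μ) :
    Integrable (fun t => ⟪f t, w t⟫) μ := by
  have h1 := (memLp_two_iff_integrable_sq_norm hf.1).1 hf
  have h2 := (memLp_two_iff_integrable_sq_norm hw.1).1 hw
  have h3 := (memLp_two_iff_integrable_sq_norm (hf.add hw).1).1 (hf.add hw)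
  refine (((h3.sub h1).sub h2).const_mul (1 / 2)).congr (Eventually.of_forall fun t => ?_)
  simp only [Pi.sub_apply, Pi.add_apply]
  rw [norm_add_sq_real]
  ring

/-- The first variation of the square of the `L²` norm vanishes at a minimum along a line. -/
theorem integral_inner_eq_zero_of_forall_le (hf : MemLp f 2 μ) (hw : MemLp w 2 μ)
    (h : ∀ s : ℝ, ∫ t, ‖f t‖ ^ 2 ∂μ ≤ ∫ t, ‖f t + s • w t‖ ^ 2 ∂μ) :
    ∫ t, ⟪f t, w t⟫ ∂μ = 0 := by
  have h1 := (memLp_two_iff_integrable_sq_norm hf.1).1 hf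
  have h2 := (memLp_two_iff_integrable_sq_norm hw.1).1 hw
  have h3 := hf.integrable_real_inner hw
  set β := ∫ t, ⟪f t, w t⟫ ∂μ
  set γ := ∫ t, ‖w t‖ ^ 2 ∂μ
  have hq : ∀ s : ℝ, 0 ≤ 2 * s * β + s ^ 2 * γ := by
    intro s
    have h4 := h s
    have h5 : ∀ t, ‖f t + s • w t‖ ^ 2 = ‖f t‖ ^ 2 + (2 * s) * ⟪f t, w t⟫ + s ^ 2 * ‖w t‖ ^ 2 := by
      intro t
      rw [norm_add_sq_real, real_inner_smul_right, norm_smul, mul_pow, Real.norm_eq_abs, sq_abs]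
      ring
    simp only [h5] at h4
    rw [integral_add (h1.fun_add (h3.const_mul _)) (h2.const_mul _), integral_add h1 (h3.const_mul _),
      integral_const_mul, integral_const_mul] at h4
    linarith
  have hγ : 0 ≤ γ := integral_nonneg fun t => by positivity
  by_contra hne
  -- The minimum of the quadratic is at `-β / γ`; the added `1` also covers `γ = 0` and still makes
  -- the value negative.
  have h6 := hq (-β / (γ + 1))
  have h7 : 2 * (-β / (γ + 1)) * β + (-β / (γ + 1)) ^ 2 * γ
      = -(β ^ 2 * (γ + 2)) / (γ + 1) ^ 2 := by
    field_simp
    ring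
  rw [h7] at h6
  have : 0 < β ^ 2 * (γ + 2) / (γ + 1) ^ 2 := by positivity
  rw [neg_div] at h6
  linarith

end FirstVariation

/-! ### Regularity for differential equations on a closed interval -/

section ODE

variable {E : Type*} [NormedAddCommGroup E] [NormedSpace ℝ E]

theorem hasDerivWithinAt_integral_of_continuousOn [CompleteSpace E] {c d : ℝ} (hcd : c ≤ d)
    {f : ℝ → E} (hf : ContinuousOn f (Icc c d)) {t : ℝ} (ht : t ∈ Icc c d) :
    HasDerivWithinAt (fun t => ∫ s in c..t, f s) (f t) (Icc c d) t := by
  -- A continuous extension to the line gives one-sided derivatives at the end points as well.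
  set F : ℝ → E := IccExtend hcd ((Icc c d).domRestrict f)
  have hF : Continuous F := (continuousOn_iff_continuous_domRestrict.1 hf).Icc_extend'
  have hFf : ∀ s ∈ Icc c d, F s = f s := fun s hs => IccExtend_of_mem hcd _ hs
  have h1 : HasDerivAt (fun t => ∫ s in c..t, F s) (F t) t :=
    intervalIntegral.integral_hasDerivAt_right (hF.intervalIntegrable _ _)
      hF.stronglyMeasurable.stronglyMeasurableAtFilter hF.continuousAt
  rw [hFf t ht] at h1
  have h2 : ∀ s ∈ Icc c d, ∫ τ in c..s, f τ = ∫ τ in c..s, F τ := by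
    intro s hs
    refine intervalIntegral.integral_congr fun τ hτ => ?_
    rw [uIcc_of_le hs.1] at hτ
    exact (hFf τ ⟨hτ.1, hτ.2.trans hs.2⟩).symm
  exact h1.hasDerivWithinAt.congr h2 (h2 t ht)

/-- Solutions of a smooth autonomous differential equation are smooth. -/
theorem contDiffOn_of_hasDerivWithinAt {I : Set ℝ} (hI : UniqueDiffOn ℝ I) {S : Set E}
    {Ψ : E → E} (hΨ : ContDiffOn ℝ ∞ Ψ S) {z : ℝ → E} (hz : MapsTo z I S)
    (h : ∀ t ∈ I, HasDerivWithinAt z (Ψ (z t)) I t) : ContDiffOn ℝ ∞ z I := by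
  rw [contDiffOn_infty]
  intro k
  -- Bootstrap: if `z` is `C^k`, so is `Ψ ∘ z`, which is the derivative of `z`.
  induction k with
  | zero =>
    rw [Nat.cast_zero, contDiffOn_zero]
    exact fun t ht => (h t ht).continuousWithinAt
  | succ k ih =>
    rw [Nat.cast_succ, contDiffOn_succ_iff_derivWithin hI]
    refine ⟨fun t ht => (h t ht).differentiableWithinAt,
      fun hω => absurd hω (by exact_mod_cast WithTop.coe_ne_top), ?_⟩
    refine ((hΨ.of_le (by exact_mod_cast le_top)).comp ih hz).congr fun t ht => ?_
    exact (h t ht).derivWithin (hI t ht)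

end ODE

/-! ### Tangential velocity and the geodesic equation on the boundary -/

namespace IsNormalField

variable {n : ℕ} {O : Set (Rn n)} {x : Rn n} {r : ℝ} {N : Rn n → Rn n}

/-- Curves on the boundary have tangential velocity. -/
theorem inner_eq_zero_of_hasDerivAt (hN : IsNormalField O x r N) {y : Rn n}
    (hy : y ∈ Metric.ball x r) (hyf : y ∈ frontier O) {c : ℝ → Rn n} {v : Rn n} {t : ℝ}
    (hct : c t = y) (hc : HasDerivAt c v t) (hO : ∀ᶠ s in 𝓝 t, c s ∉ O) : ⟪N y, v⟫ = 0 := by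
  rcases lt_trichotomy ⟪N y, v⟫ 0 with h | h | h
  · obtain ⟨s, h1, h2⟩ := ((hN.eventually_mem y hy hyf c v t hct hc.hasDerivWithinAt h).and
      (hO.filter_mono nhdsWithin_le_nhds)).exists
    exact absurd h1 h2
  · exact h
  · have hc' : HasDerivAt (fun s => c (2 * t - s)) (-v) t := by
      have h1 : HasDerivAt c v (2 * t - t) := by rwa [show 2 * t - t = t by ring]
      exact h1.comp_const_sub (2 * t) t
    have hcont : Tendsto (fun s : ℝ => 2 * t - s) (𝓝 t) (𝓝 t) := by
      have : Tendsto (fun s : ℝ => 2 * t - s) (𝓝 t) (𝓝 (2 * t - t)) :=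
        Continuous.tendsto (by fun_prop) t
      rwa [show 2 * t - t = t by ring] at this
    obtain ⟨s, h1, h2⟩ := ((hN.eventually_mem y hy hyf _ (-v) t
      (by rw [show 2 * t - t = t by ring, hct]) hc'.hasDerivWithinAt
      (by rw [inner_neg_right]; linarith)).and
      ((hcont.eventually hO).filter_mono nhdsWithin_le_nhds)).exists
    exact absurd h1 h2

end IsNormalField

section LocalRegularity

variable {n : ℕ} {O : Set (Rn n)} {p q : Rn n} {u : ℝ → Rn n} {x : Rn n} {r : ℝ}
  {N : Rn n → Rn n} {c d : ℝ}

/-- The tangential part of the constant field `e`. -/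
noncomputable def tangentialPart (N : Rn n → Rn n) (e y : Rn n) : Rn n := e - ⟪N y, e⟫ • N y

theorem IsNormalField.contDiffOn_tangentialPart (hN : IsNormalField O x r N) (e : Rn n) :
    ContDiffOn ℝ ∞ (tangentialPart N e) (Metric.ball x r) :=
  contDiffOn_const.sub ((hN.contDiffOn.inner ℝ contDiffOn_const).smul hN.contDiffOn)

theorem IsNormalField.contDiffOn_fderiv (hN : IsNormalField O x r N) :
    ContDiffOn ℝ ∞ (fderiv ℝ N) (Metric.ball x r) :=
  hN.contDiffOn.fderiv_of_isOpen Metric.isOpen_ball (by simp)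

theorem IsNormalField.hasFDerivAt (hN : IsNormalField O x r N) {y : Rn n}
    (hy : y ∈ Metric.ball x r) : HasFDerivAt N (fderiv ℝ N y) y :=
  ((hN.contDiffOn.contDiffAt (Metric.isOpen_ball.mem_nhds hy)).differentiableAt
    (by simp)).hasFDerivAt

theorem IsNormalField.inner_tangentialPart (hN : IsNormalField O x r N) {y : Rn n}
    (hy : y ∈ Metric.ball x r) (e : Rn n) : ⟪N y, tangentialPart N e y⟫ = 0 := by
  rw [tangentialPart, inner_sub_right, real_inner_smul_right, real_inner_self_eq_norm_sq,
    hN.norm_eq_one y hy]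
  ring

/-- The velocity of a curve on the boundary is almost everywhere tangential. -/
theorem IsPrimitiveOn.ae_inner_eq_zero {g : ℝ → Rn n} (hu : IsPrimitiveOn c d u g)
    (hO : IsOpen O) (hN : IsNormalField O x r N) (hfr : ∀ t ∈ Icc c d, u t ∈ frontier O)
    (hball : ∀ t ∈ Icc c d, u t ∈ Metric.ball x r) :
    ∀ᵐ t, t ∈ Ioo c d → ⟪N (u t), g t⟫ = 0 := by
  filter_upwards [hu.ae_hasDerivAt] with t ht htI
  have hI := Ioo_subset_Icc_self htI
  refine hN.inner_eq_zero_of_hasDerivAt (hball t hI) (hfr t hI) rfl (ht htI) ?_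
  filter_upwards [Ioo_mem_nhds htI.1 htI.2] with s hs
  have := hfr s (Ioo_subset_Icc_self hs)
  rw [hO.frontier_eq] at this
  exact this.2

/-- The derivative of the tangential variation `ψ • tangentialPart N e (u ·)`, given the derivative
`g` of `u`. -/
noncomputable def variationDeriv (N : Rn n → Rn n) (u g : ℝ → Rn n) (e : Rn n) (ψ : ℝ → ℝ)
    (t : ℝ) : Rn n :=
  deriv ψ t • tangentialPart N e (u t) -
    ψ t • (⟪fderiv ℝ N (u t) (g t), e⟫ • N (u t) + ⟪N (u t), e⟫ • fderiv ℝ N (u t) (g t))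

/-- Pairing with a tangential `g t` kills every multiple of `N (u t)`. What remains is linear in
`e`, so letting `e` vary gives a vector equation whose force term is normal. -/
theorem inner_variationDeriv {g : ℝ → Rn n} {t : ℝ} (ht : ⟪N (u t), g t⟫ = 0) (e : Rn n) (ψ : ℝ → ℝ) :
    ⟪g t, variationDeriv N u g e ψ t⟫ =
      deriv ψ t * ⟪g t, e⟫ - ψ t * ⟪⟪g t, fderiv ℝ N (u t) (g t)⟫ • N (u t), e⟫ := by
  have ht' : ⟪g t, N (u t)⟫ = 0 := by rw [real_inner_comm]; exact ht
  simp only [variationDeriv, tangentialPart, inner_sub_right, inner_add_right,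
    real_inner_smul_right, real_inner_smul_left, ht']
  ring

theorem memLp_of_continuousOn {E : Type*} [NormedAddCommGroup E] {f : ℝ → E}
    (hf : ContinuousOn f (Icc c d)) : MemLp f 2 (volume.restrict (Ioo c d)) := by
  obtain ⟨B, hB⟩ := isCompact_Icc.exists_bound_of_continuousOn hf
  have : MemLp f 2 (volume.restrict (Icc c d)) :=
    MemLp.of_bound (hf.aestronglyMeasurable measurableSet_Icc) B
      ((ae_restrict_iff' measurableSet_Icc).2 (Eventually.of_forall hB))
  exact this.mono_measure (Measure.restrict_mono Ioo_subset_Icc_self le_rfl)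

theorem _root_.MeasureTheory.MemLp.continuousOn_clm_apply {E F : Type*} [NormedAddCommGroup E]
    [NormedSpace ℝ E] [NormedAddCommGroup F] [NormedSpace ℝ F] {A : ℝ → E →L[ℝ] F} {g : ℝ → E}
    (hg : MemLp g 2 (volume.restrict (Ioo c d))) (hA : ContinuousOn A (Icc c d)) :
    MemLp (fun t => A t (g t)) 2 (volume.restrict (Ioo c d)) := by
  obtain ⟨B, hB⟩ := isCompact_Icc.exists_bound_of_continuousOn hA
  have hAm := (hA.mono Ioo_subset_Icc_self).aestronglyMeasurable (μ := volume) measurableSet_Ioo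
  refine hg.of_le_mul (c := B)
    ((ContinuousLinearMap.id ℝ (E →L[ℝ] F)).aestronglyMeasurable_comp₂ hAm hg.1) ?_
  refine (ae_restrict_iff' measurableSet_Ioo).2 (Eventually.of_forall fun t ht => ?_)
  exact (A t).le_of_opNorm_le (hB t (Ioo_subset_Icc_self ht)) _

/-- On `[c,d]` the curve `u` stays on the boundary of `O`, within a ball on which `N` is a normal
field of `O`. -/
structure IsBoundaryArc (O : Set (Rn n)) (x : Rn n) (r : ℝ) (N : Rn n → Rn n) (c d : ℝ)
    (u : ℝ → Rn n) : Prop where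
  lt : c < d
  pos : 0 < r
  isNormalField : IsNormalField O x r N
  mem_closedBall : ∀ t ∈ Icc c d, u t ∈ Metric.closedBall x (r / 2)
  mem_frontier : ∀ t ∈ Icc c d, u t ∈ frontier O

namespace IsBoundaryArc

theorem closedBall_subset (h : IsBoundaryArc O x r N c d u) :
    Metric.closedBall x (r / 2) ⊆ Metric.ball x r :=
  Metric.closedBall_subset_ball (by linarith [h.pos])

theorem mem_ball (h : IsBoundaryArc O x r N c d u) : ∀ t ∈ Icc c d, u t ∈ Metric.ball x r :=
  fun t ht => h.closedBall_subset (h.mem_closedBall t ht)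

theorem continuousOn_comp (h : IsBoundaryArc O x r N c d u) {F : Type*} [TopologicalSpace F]
    {f : Rn n → F} (hf : ContinuousOn f (Metric.ball x r)) (hu : ContinuousOn u (Icc c d)) :
    ContinuousOn (fun t => f (u t)) (Icc c d) :=
  hf.comp hu h.mem_ball

/-- A smooth function on the open ball is Lipschitz on the compact convex half-radius ball; hence
`mem_closedBall` in `IsBoundaryArc`. -/
theorem absolutelyContinuousOnInterval_comp (h : IsBoundaryArc O x r N c d u)
    {F : Type*} [NormedAddCommGroup F] [NormedSpace ℝ F] {f : Rn n → F}
    (hf : ContDiffOn ℝ ∞ f (Metric.ball x r)) (hu : AbsolutelyContinuousOnInterval u c d) :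
    AbsolutelyContinuousOnInterval (fun t => f (u t)) c d := by
  obtain ⟨K, hK⟩ := (hf.mono h.closedBall_subset).exists_lipschitzOnWith (by simp)
    (convex_closedBall _ _) (isCompact_closedBall _ _)
  refine hu.of_dist_le (K := K) fun s hs t ht => ?_
  rw [uIcc_of_le h.lt.le] at hs ht
  exact hK.dist_le_mul _ (h.mem_closedBall s hs) _ (h.mem_closedBall t ht)

variable {g : ℝ → Rn n}

theorem memLp_fderiv (h : IsBoundaryArc O x r N c d u) (hu : ContinuousOn u (Icc c d))
    (hg : MemLp g 2 (volume.restrict (Ioo c d))) :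
    MemLp (fun t => fderiv ℝ N (u t) (g t)) 2 (volume.restrict (Ioo c d)) :=
  hg.continuousOn_clm_apply
    (h.continuousOn_comp h.isNormalField.contDiffOn_fderiv.continuousOn hu)

theorem continuousOn_normal (h : IsBoundaryArc O x r N c d u) (hu : ContinuousOn u (Icc c d)) :
    ContinuousOn (fun t => N (u t)) (Icc c d) :=
  h.continuousOn_comp h.isNormalField.contDiffOn.continuousOn hu

theorem memLp_variationDeriv (h : IsBoundaryArc O x r N c d u) (hu : ContinuousOn u (Icc c d))
    (hg : MemLp g 2 (volume.restrict (Ioo c d))) (e : Rn n) {ψ : ℝ → ℝ} (hψ : ContDiff ℝ ∞ ψ) :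
    MemLp (variationDeriv N u g e ψ) 2 (volume.restrict (Ioo c d)) := by
  have hNc := h.continuousOn_normal hu
  have hD := h.memLp_fderiv hu hg
  have h1 : MemLp (fun t => deriv ψ t • tangentialPart N e (u t)) 2
      (volume.restrict (Ioo c d)) :=
    memLp_of_continuousOn ((hψ.continuous_deriv (by simp)).continuousOn.smul
      (h.continuousOn_comp (h.isNormalField.contDiffOn_tangentialPart e).continuousOn hu))
  have h2 := hD.continuousOn_clm_apply
    (A := fun t => ψ t • ((innerSL ℝ e).smulRight (N (u t)) +
      ⟪N (u t), e⟫ • ContinuousLinearMap.id ℝ (Rn n)))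
    (hψ.continuous.continuousOn.smul (ContinuousOn.add
      (((ContinuousLinearMap.smulRightL ℝ (Rn n) (Rn n)) (innerSL ℝ e)).continuous.comp_continuousOn
        hNc)
      ((hNc.inner continuousOn_const).fun_smul continuousOn_const)))
  refine (h1.sub h2).ae_eq (Eventually.of_forall fun t => ?_)
  simp [variationDeriv, real_inner_comm]

theorem isPrimitiveOn_variation (h : IsBoundaryArc O x r N c d u) (hu : IsPrimitiveOn c d u g)
    (hg : MemLp g 2 (volume.restrict (Ioo c d))) (e : Rn n) {ψ : ℝ → ℝ} (hψ : ContDiff ℝ ∞ ψ) :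
    IsPrimitiveOn c d (fun t => ψ t • tangentialPart N e (u t)) (variationDeriv N u g e ψ) := by
  have hcd := h.lt.le
  have hN := h.isNormalField
  have huc := hu.continuousOn hcd
  refine IsPrimitiveOn.of_absolutelyContinuousOnInterval hcd ?_
    ((h.memLp_variationDeriv huc hg e hψ).intervalIntegrable_Ioo hcd) ?_
  · exact ((hψ.of_le (by simp)).contDiffOn.absolutelyContinuousOnInterval).fun_smul
      (h.absolutelyContinuousOnInterval_comp (hN.contDiffOn_tangentialPart e)
        (hu.absolutelyContinuousOnInterval hcd))
  · filter_upwards [hu.ae_hasDerivAt] with t ht htI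
    have hNt : HasDerivAt (fun t => N (u t)) (fderiv ℝ N (u t) (g t)) t :=
      (hN.hasFDerivAt (h.mem_ball t (Ioo_subset_Icc_self htI))).comp_hasDerivAt t (ht htI)
    have h1 := (hψ.differentiable (by simp) t).hasDerivAt.fun_smul
      (((hNt.inner ℝ (hasDerivAt_const t e)).fun_smul hNt).const_sub e)
    refine h1.congr_deriv ?_
    simp only [variationDeriv, tangentialPart, inner_zero_right, zero_add]
    module

theorem integrableOn_acceleration (h : IsBoundaryArc O x r N c d u)
    (hu : ContinuousOn u (Icc c d)) (hg : MemLp g 2 (volume.restrict (Ioo c d))) :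
    IntegrableOn (fun s => ⟪g s, fderiv ℝ N (u s) (g s)⟫ • N (u s)) (Ioo c d) := by
  refine (hg.integrable_real_inner (h.memLp_fderiv hu hg)).smul_bdd 1
    (((h.continuousOn_normal hu).mono Ioo_subset_Icc_self).aestronglyMeasurable
      measurableSet_Ioo) ?_
  refine (ae_restrict_iff' measurableSet_Ioo).2 (Eventually.of_forall fun t ht => ?_)
  exact (h.isNormalField.norm_eq_one _ (h.mem_ball t (Ioo_subset_Icc_self ht))).le

/-- The Euler-Lagrange equation of a minimizer on the boundary, integrated once. -/
theorem exists_ae_eq (h : IsBoundaryArc O x r N c d u) (hO : IsOpen O)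
    (hmin : IsEnergyMinimizer O p q u) (hc : 0 ≤ c) (hd : d ≤ 1) :
    ∃ C : Rn n, ∀ᵐ t, t ∈ Ioo c d → weakDeriv u t = C - ∫ s in c..t,
      ⟪weakDeriv u s, fderiv ℝ N (u s) (weakDeriv u s)⟫ • N (u s) := by
  set g := weakDeriv u with hgdef
  have hcd := h.lt.le
  have hN := h.isNormalField
  have hu : IsPrimitiveOn c d u g := hmin.isPrimitiveOn.mono hc hcd hd
  have huc := hu.continuousOn hcd
  have hg : MemLp g 2 (volume.restrict (Ioo c d)) := hmin.memLp_of_le hc hd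
  have hgi : IntegrableOn g (Ioo c d) := hg.integrable (by norm_num)
  set F : ℝ → Rn n := fun s => ⟪g s, fderiv ℝ N (u s) (g s)⟫ • N (u s) with hF
  have hFi : IntegrableOn F (Ioo c d) := h.integrableOn_acceleration huc hg
  set K : ℝ → Rn n := fun t => ∫ s in c..t, F s with hK
  have hKp : IsPrimitiveOn c d K F :=
    ⟨(intervalIntegrable_iff_integrableOn_Ioo_of_le hcd).2 hFi, fun t _ => by simp [K]⟩
  have hKi : IntegrableOn K (Ioo c d) :=
    ((hKp.continuousOn hcd).integrableOn_compact isCompact_Icc).mono_set Ioo_subset_Icc_self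
  -- Integrating the force `F` by parts turns the weak equation `∫ (ψ' g - ψ F) = 0` into `∫ ψ' (g +
  -- K) = 0`.
  obtain ⟨C, hC⟩ := ae_eq_const_of_integral_deriv_smul_eq_zero h.lt (f := fun t => g t + K t)
    (hgi.add hKi) (by
    intro ψ hψ hψc hψs
    have hψ' : Continuous (deriv ψ) := hψ.continuous_deriv (by simp)
    have hψ0 : ∀ t, t ∉ Ioo c d → ψ t = 0 := fun t ht => by
      by_contra h0
      exact ht (hψs (subset_tsupport ψ h0))
    obtain ⟨B, hB⟩ := hψc.exists_bound_of_continuous hψ.continuous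
    obtain ⟨B', hB'⟩ := hψc.deriv.exists_bound_of_continuous hψ'
    have i1 : IntegrableOn (fun t => deriv ψ t • g t) (Ioo c d) :=
      hgi.bdd_smul B' hψ'.aestronglyMeasurable (Eventually.of_forall hB')
    have i2 : IntegrableOn (fun t => deriv ψ t • K t) (Ioo c d) :=
      hKi.bdd_smul B' hψ'.aestronglyMeasurable (Eventually.of_forall hB')
    have i3 : IntegrableOn (fun t => ψ t • F t) (Ioo c d) :=
      hFi.bdd_smul B hψ.continuous.aestronglyMeasurable (Eventually.of_forall hB)
    have hparts := hKp.integral_deriv_smul hcd hψ hψs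
    refine ext_inner_left ℝ fun e => ?_
    have hWp := h.isPrimitiveOn_variation hu hg e hψ
    have hWL := h.memLp_variationDeriv huc hg e hψ
    have hvar : ∫ t in Ioo c d, ⟪g t, variationDeriv N u g e ψ t⟫ = 0 := by
      refine integral_inner_eq_zero_of_forall_le hg hWL fun s => ?_
      -- The varied point stays on the supporting hyperplane at `u t`, which misses `O` for every
      -- real `s`; it need not lie on the boundary.
      have h1 := hmin.integral_norm_sq_le hc hcd hd (hu.add (hWp.const_smul s))
        (hg.add (hWL.const_smul s)) (by simp [hψ0 c]) (by simp [hψ0 d]) (fun t ht hmem => by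
          have h2 := hN.inner_neg _ (h.mem_ball t ht) (h.mem_frontier t ht) _ hmem
          rw [add_sub_cancel_left, real_inner_smul_right, real_inner_smul_right,
            hN.inner_tangentialPart (h.mem_ball t ht)] at h2
          simp at h2)
      rwa [intervalIntegral.integral_of_le hcd, intervalIntegral.integral_of_le hcd,
        integral_Ioc_eq_integral_Ioo, integral_Ioc_eq_integral_Ioo] at h1
    have hae : ∀ᵐ t ∂volume.restrict (Ioo c d), ⟪g t, variationDeriv N u g e ψ t⟫ =
        ⟪e, deriv ψ t • g t - ψ t • F t⟫ := by
      refine (ae_restrict_iff' measurableSet_Ioo).2 ?_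
      filter_upwards [hu.ae_inner_eq_zero hO hN h.mem_frontier h.mem_ball] with t ht htI
      rw [inner_variationDeriv (ht htI), inner_sub_right, real_inner_smul_right,
        real_inner_smul_right, real_inner_comm (g t) e, real_inner_comm (F t) e]
    rw [integral_congr_ae hae, integral_inner (i1.fun_sub i3), integral_sub i1 i3] at hvar
    simp only [smul_add]
    rw [integral_add i1 i2, hparts, ← sub_eq_add_neg, hvar, inner_zero_right])
  refine ⟨C, ?_⟩
  filter_upwards [hC] with t ht htI
  rw [← ht htI, add_sub_cancel_right]

/-- A minimizer on the boundary solves the geodesic equation. -/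
theorem exists_velocity (h : IsBoundaryArc O x r N c d u) (hO : IsOpen O)
    (hmin : IsEnergyMinimizer O p q u) (hc : 0 ≤ c) (hd : d ≤ 1) :
    ∃ w : ℝ → Rn n, (∀ t ∈ Icc c d, HasDerivWithinAt u (w t) (Icc c d) t) ∧
      ∀ t ∈ Icc c d,
        HasDerivWithinAt w (-(⟪w t, fderiv ℝ N (u t) (w t)⟫ • N (u t))) (Icc c d) t := by
  obtain ⟨C, hC⟩ := h.exists_ae_eq hO hmin hc hd
  set g := weakDeriv u with hgdef
  have hcd := h.lt.le
  have hN := h.isNormalField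
  have hu : IsPrimitiveOn c d u g := hmin.isPrimitiveOn.mono hc hcd hd
  have huc := hu.continuousOn hcd
  have hg : MemLp g 2 (volume.restrict (Ioo c d)) := hmin.memLp_of_le hc hd
  have hNc := h.continuousOn_normal huc
  set F : ℝ → Rn n := fun s => ⟪g s, fderiv ℝ N (u s) (g s)⟫ • N (u s) with hF
  have hFi : IntegrableOn F (Ioo c d) := h.integrableOn_acceleration huc hg
  have hKp : IsPrimitiveOn c d (fun t => ∫ s in c..t, F s) F :=
    ⟨(intervalIntegrable_iff_integrableOn_Ioo_of_le hcd).2 hFi, fun t _ => by simp⟩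
  -- `w` is a continuous representative of the weak derivative. Replacing `g` by `w` under the
  -- integrals leaves continuous integrands, so both derivatives exist at every point.
  set w : ℝ → Rn n := fun t => C - ∫ s in c..t, F s with hw
  have hwc : ContinuousOn w (Icc c d) := continuousOn_const.sub (hKp.continuousOn hcd)
  have hd' : ∀ᵐ t : ℝ, t ≠ d := by simp [ae_iff, measure_singleton]
  have hgw : ∀ t ∈ Icc c d, ∀ᵐ s, s ∈ uIoc c t → g s = w s := by
    intro t ht
    filter_upwards [hC, hd'] with s hs hsd hst
    rw [uIoc_of_le ht.1] at hst
    exact hs ⟨hst.1, lt_of_le_of_ne (hst.2.trans ht.2) hsd⟩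
  set F' : ℝ → Rn n := fun s => ⟪w s, fderiv ℝ N (u s) (w s)⟫ • N (u s) with hF'
  have hF'c : ContinuousOn F' (Icc c d) :=
    (hwc.inner ((h.continuousOn_comp hN.contDiffOn_fderiv.continuousOn huc).clm_apply hwc)).fun_smul hNc
  refine ⟨w, fun t ht => ?_, fun t ht => ?_⟩
  · have h1 := (hasDerivWithinAt_integral_of_continuousOn hcd hwc ht).const_add (u c)
    have h2 : ∀ s ∈ Icc c d, u s = u c + ∫ τ in c..s, w τ := by
      intro s hs
      rw [hu.eq_add s hs, intervalIntegral.integral_congr_ae (hgw s hs)]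
    exact h1.congr h2 (h2 t ht)
  · have h1 := (hasDerivWithinAt_integral_of_continuousOn hcd hF'c ht).const_sub C
    have h2 : ∀ s ∈ Icc c d, w s = C - ∫ τ in c..s, F' τ := by
      intro s hs
      simp only [hw]
      rw [intervalIntegral.integral_congr_ae (g := F')]
      filter_upwards [hgw s hs] with τ hτ hτs
      simp only [hF, hF', hτ hτs]
    exact h1.congr h2 (h2 t ht)

/-- The geodesic equation is a smooth first-order system for the pair of position and velocity. -/
theorem contDiffOn (h : IsBoundaryArc O x r N c d u) (hO : IsOpen O)
    (hmin : IsEnergyMinimizer O p q u) (hc : 0 ≤ c) (hd : d ≤ 1) :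
    ContDiffOn ℝ ∞ u (Icc c d) ∧
      ∀ t ∈ Icc c d, ∃ l : ℝ, iteratedDerivWithin 2 u (Icc c d) t = l • N (u t) := by
  obtain ⟨w, hw1, hw2⟩ := h.exists_velocity hO hmin hc hd
  have hN := h.isNormalField
  have hI := uniqueDiffOn_Icc h.lt
  constructor
  · set Ψ : Rn n × Rn n → Rn n × Rn n :=
      fun y => (y.2, -(⟪y.2, fderiv ℝ N y.1 y.2⟫ • N y.1))
    have hΨ : ContDiffOn ℝ ∞ Ψ (Metric.ball x r ×ˢ univ) := by
      have h1 : ContDiffOn ℝ ∞ (fun y : Rn n × Rn n => fderiv ℝ N y.1) (Metric.ball x r ×ˢ univ) :=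
        hN.contDiffOn_fderiv.comp contDiffOn_fst fun y hy => hy.1
      have h2 : ContDiffOn ℝ ∞ (fun y : Rn n × Rn n => N y.1) (Metric.ball x r ×ˢ univ) :=
        hN.contDiffOn.comp contDiffOn_fst fun y hy => hy.1
      exact contDiffOn_snd.prodMk
        ((contDiffOn_snd.inner ℝ (h1.clm_apply contDiffOn_snd)).smul h2).neg
    have := contDiffOn_of_hasDerivWithinAt hI hΨ (z := fun t => (u t, w t))
      (fun t ht => ⟨h.mem_ball t ht, mem_univ _⟩) fun t ht => (hw1 t ht).prodMk (hw2 t ht)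
    exact contDiff_fst.comp_contDiffOn this
  · intro t ht
    refine ⟨-⟪w t, fderiv ℝ N (u t) (w t)⟫, ?_⟩
    rw [iteratedDerivWithin_succ, iteratedDerivWithin_one, neg_smul]
    have : HasDerivWithinAt (derivWithin u (Icc c d))
        (-(⟪w t, fderiv ℝ N (u t) (w t)⟫ • N (u t))) (Icc c d) t :=
      (hw2 t ht).congr (fun s hs => (hw1 s hs).derivWithin (hI s hs))
        ((hw1 t ht).derivWithin (hI t ht))
    exact this.derivWithin (hI t ht)

end IsBoundaryArc

theorem inner_eq_zero_of_mem_tangentVectors (hO : IsOpen O) (hN : IsNormalField O x r N)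
    (hr : 0 < r) {v : Rn n} (hx : x ∈ frontier O) (hv : v ∈ tangentVectors (frontier O) x) :
    ⟪N x, v⟫ = 0 := by
  obtain ⟨ε, γ, hε, hγ, hγS, hγ0, rfl⟩ := hv
  have hnhds : Ioo (-ε) ε ∈ 𝓝 (0 : ℝ) := Ioo_mem_nhds (by linarith) hε
  refine hN.inner_eq_zero_of_hasDerivAt (Metric.mem_ball_self hr) hx hγ0
    ((hγ.contDiffAt hnhds).differentiableAt (by simp)).hasDerivAt ?_
  filter_upwards [hnhds] with s hs
  have := hγS s hs
  rw [hO.frontier_eq] at this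
  exact this.2

/-- A minimizer of the energy is a geodesic as long as it stays on the boundary. -/
theorem IsEnergyMinimizer.isGeodesicOn (hmin : IsEnergyMinimizer O p q u) (hO : IsOpen O)
    (hconv : Convex ℝ O) (hsm : HasSmoothBoundary O) {a b : ℝ} (ha : 0 ≤ a) (hab : a < b)
    (hb : b ≤ 1) (hfr : ∀ t ∈ Icc a b, u t ∈ frontier O) : IsGeodesicOn (frontier O) u a b := by
  have hloc : ∀ t ∈ Icc a b, ContDiffWithinAt ℝ ∞ u (Icc a b) t ∧
      ∀ v ∈ tangentVectors (frontier O) (u t),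
        ⟪iteratedDerivWithin 2 u (Icc a b) t, v⟫ = 0 := by
    intro t ht
    obtain ⟨r, hr, N, hN⟩ := exists_isNormalField hO hconv hsm (hfr t ht)
    have hcont : ContinuousWithinAt u (Icc a b) t :=
      (hmin.1.2.1.mono (Icc_subset_Icc ha hb)) t ht
    obtain ⟨δ, hδ, hball⟩ := Metric.continuousWithinAt_iff.1 hcont (r / 2) (by linarith)
    -- Near `t` the curve stays in the half-radius ball of a normal field; truncation at `a` and `b`
    -- allows `t` to be an end point. Derivatives within `[a,b]` at `t` depend only on the set near
    -- `t`.
    set c := max a (t - δ / 2) with hc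
    set d := min b (t + δ / 2) with hd
    have hac : a ≤ c := le_max_left _ _
    have hdb : d ≤ b := min_le_left _ _
    have hcd : c < d := by
      rw [hc, hd, max_lt_iff, lt_min_iff, lt_min_iff]
      exact ⟨⟨hab, by linarith [ht.1]⟩, by linarith [ht.2], by linarith⟩
    have harc : IsBoundaryArc O (u t) r N c d u := by
      refine ⟨hcd, hr, hN, fun s hs => ?_, fun s hs => hfr s ⟨hac.trans hs.1, hs.2.trans hdb⟩⟩
      refine (hball ⟨hac.trans hs.1, hs.2.trans hdb⟩ ?_).le
      have h1 : t - δ / 2 ≤ s := (le_max_right _ _).trans hs.1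
      have h2 : s ≤ t + δ / 2 := hs.2.trans (min_le_right _ _)
      rw [Real.dist_eq, abs_lt]
      constructor <;> linarith
    have htcd : t ∈ Icc c d :=
      ⟨max_le ht.1 (by linarith), le_min ht.2 (by linarith)⟩
    have hnear : Icc a b =ᶠ[𝓝 t] Icc c d := by
      filter_upwards [Ioo_mem_nhds (a := t - δ / 2) (b := t + δ / 2) (by linarith) (by linarith)]
        with s hs
      refine propext ⟨fun h => ⟨max_le h.1 hs.1.le, le_min h.2 hs.2.le⟩,
        fun h => ⟨hac.trans h.1, h.2.trans hdb⟩⟩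
    obtain ⟨h1, h2⟩ := harc.contDiffOn hO hmin (ha.trans hac) (hdb.trans hb)
    refine ⟨(h1 t htcd).congr_set hnear.symm, fun v hv => ?_⟩
    obtain ⟨l, hl⟩ := h2 t htcd
    rw [iteratedDerivWithin, iteratedFDerivWithin_congr_set hnear, ← iteratedDerivWithin, hl,
      real_inner_smul_left, inner_eq_zero_of_mem_tangentVectors hO hN hr (hfr t ht) hv, mul_zero]
  exact ⟨fun t ht => (hloc t ht).1, hfr, fun t ht => (hloc t ht).2⟩

end LocalRegularity

/-! ### Length versus energy -/

section Length

/-- The integral of `‖g‖` is monotone and its increments dominate those of `u`. -/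
theorem IsPrimitiveOn.eVariationOn_le {E : Type*} [NormedAddCommGroup E] [NormedSpace ℝ E]
    {c d : ℝ} {u g : ℝ → E} (h : IsPrimitiveOn c d u g) (hcd : c ≤ d) :
    eVariationOn u (Icc c d) ≤ ENNReal.ofReal (∫ t in c..d, ‖g t‖) := by
  have hc : c ∈ Icc c d := left_mem_Icc.2 hcd
  have hd : d ∈ Icc c d := right_mem_Icc.2 hcd
  set V : ℝ → ℝ := fun t => ∫ s in c..t, ‖g s‖ with hV
  have hVsub : ∀ x ∈ Icc c d, ∀ y ∈ Icc c d, V y - V x = ∫ s in x..y, ‖g s‖ := fun x hx y hy =>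
    intervalIntegral.integral_interval_sub_left (h.intervalIntegrable_of_mem hc hy).norm
      (h.intervalIntegrable_of_mem hc hx).norm
  have hmono : MonotoneOn V (Icc c d) := by
    intro x hx y hy hxy
    have := hVsub x hx y hy
    have h2 : 0 ≤ ∫ s in x..y, ‖g s‖ :=
      intervalIntegral.integral_nonneg hxy fun _ _ => norm_nonneg _
    linarith
  have hle : eVariationOn u (Icc c d) ≤ eVariationOn V (Icc c d) := by
    refine iSup_mono fun p => Finset.sum_le_sum fun i _ => ?_
    have h1 := p.2.2.2 i
    have h2 := p.2.2.2 (i + 1)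
    rw [edist_dist, edist_dist]
    refine ENNReal.ofReal_le_ofReal ?_
    rw [dist_eq_norm, h.sub_eq h1 h2, Real.dist_eq, hVsub _ h1 _ h2]
    exact intervalIntegral.norm_integral_le_abs_integral_norm
  refine hle.trans ?_
  have h3 := hmono.eVariationOn_eq hc hd
  rw [inter_self] at h3
  rw [h3]
  simp [hV]

/-- The one-sided jumps of the variation are those of `f`, hence zero. Continuity makes arc length
attain every intermediate value. -/
theorem continuousOn_variationOnFromTo {E : Type*} [PseudoMetricSpace E] {f : ℝ → E} {s : Set ℝ}
    (hf : LocallyBoundedVariationOn f s) (hc : ContinuousOn f s) {a : ℝ} (ha : a ∈ s) :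
    ContinuousOn (variationOnFromTo f s a) s := by
  intro b hb
  have h1 := variationOnFromTo.tendsto_left ha hb hf ((hc b hb).mono inter_subset_left)
  have h2 := variationOnFromTo.tendsto_right ha hb hf ((hc b hb).mono inter_subset_left)
  rw [dist_self, sub_zero] at h1
  rw [dist_self, add_zero] at h2
  have h1' : ContinuousWithinAt (variationOnFromTo f s a) (s ∩ Iio b) b := h1
  have h2' : ContinuousWithinAt (variationOnFromTo f s a) (s ∩ Ioi b) b := h2
  refine ((h1'.union h2').union continuousWithinAt_singleton).mono fun x hx => ?_
  rcases lt_trichotomy x b with h | h | h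
  · exact Or.inl (Or.inl ⟨hx, h⟩)
  · exact Or.inr h
  · exact Or.inl (Or.inr ⟨hx, h⟩)

/-- A rectifiable curve on `[a,b]` can be reparametrized by constant speed. -/
theorem exists_lipschitzOnWith_reparametrization {E : Type*} [MetricSpace E] {σ : ℝ → E} {a b : ℝ}
    (hab : a < b) (hσ : ContinuousOn σ (Icc a b)) (hL : eVariationOn σ (Icc a b) ≠ ⊤) :
    ∃ τ : ℝ → E, τ a = σ a ∧ τ b = σ b ∧ MapsTo τ (Icc a b) (σ '' Icc a b) ∧
      LipschitzOnWith (Real.toNNReal ((eVariationOn σ (Icc a b)).toReal / (b - a))) τ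
        (Icc a b) := by
  set s := Icc a b with hs
  have ha : a ∈ s := left_mem_Icc.2 hab.le
  have hb : b ∈ s := right_mem_Icc.2 hab.le
  have hba : 0 < b - a := sub_pos.2 hab
  have hbv : LocallyBoundedVariationOn σ s := BoundedVariationOn.locallyBoundedVariationOn hL
  set V := variationOnFromTo σ s a with hV
  set l := (eVariationOn σ s).toReal with hl
  have hl0 : 0 ≤ l := ENNReal.toReal_nonneg
  have hVa : V a = 0 := variationOnFromTo.self _ _ _
  have hVb : V b = l := by
    rw [hV, variationOnFromTo.eq_of_le _ _ hab.le, hs, inter_self]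
  have himg : Icc 0 l ⊆ V '' s := by
    have := intermediate_value_Icc hab.le (continuousOn_variationOnFromTo hbv hσ ha)
    rwa [← hV, hVa, hVb] at this
  set Φ := naturalParameterization σ s a with hΦ
  have hspeed : HasUnitSpeedOn Φ (V '' s) := has_unit_speed_naturalParameterization σ hbv ha
  have hΦV : ∀ t ∈ s, Φ (V t) = σ t := fun t ht =>
    edist_eq_zero.1 (edist_naturalParameterization_eq_zero hbv ha ht)
  have hedist : ∀ x ∈ Icc 0 l, ∀ y ∈ Icc 0 l, x ≤ y → edist (Φ x) (Φ y) ≤ ENNReal.ofReal (y - x) := by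
    intro x hx y hy hxy
    have h1 := hspeed (himg hx) (himg hy)
    rw [NNReal.coe_one, one_mul] at h1
    rw [← h1]
    exact eVariationOn.edist_le Φ ⟨himg hx, le_rfl, hxy⟩ ⟨himg hy, hxy, le_rfl⟩
  -- The affine map of `[a,b]` onto `[0,l]`, composed with the arc length parametrization; `l = 0`
  -- is allowed.
  set θ : ℝ → ℝ := fun t => l / (b - a) * (t - a) with hθ
  have hθI : ∀ t ∈ s, θ t ∈ Icc 0 l := by
    intro t ht
    refine ⟨mul_nonneg (by positivity) (sub_nonneg.2 ht.1), ?_⟩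
    calc l / (b - a) * (t - a) ≤ l / (b - a) * (b - a) := by
          gcongr
          exact ht.2
      _ = l := by field_simp
  have hθa : θ a = V a := by simp [hθ, hVa]
  have hθb : θ b = V b := by
    rw [hVb]
    simp only [hθ]
    field_simp
  refine ⟨fun t => Φ (θ t), ?_, ?_, fun t ht => ?_, ?_⟩
  · simp only [hθa]
    exact hΦV a ha
  · simp only [hθb]
    exact hΦV b hb
  · obtain ⟨t', ht', he⟩ := himg (hθI t ht)
    refine ⟨t', ht', ?_⟩
    simp only [← he]
    exact (hΦV t' ht').symm
  · have key : ∀ x ∈ s, ∀ y ∈ s, x ≤ y → edist (Φ (θ x)) (Φ (θ y)) ≤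
        (Real.toNNReal (l / (b - a)) : ENNReal) * edist x y := by
      intro x hx y hy hxy
      have hle : θ x ≤ θ y := by
        simp only [hθ]
        gcongr
      refine (hedist _ (hθI x hx) _ (hθI y hy) hle).trans_eq ?_
      rw [edist_comm, edist_dist, Real.dist_eq, abs_of_nonneg (sub_nonneg.2 hxy),
        ← ENNReal.ofReal, ← ENNReal.ofReal_mul (by positivity)]
      congr 1
      simp only [hθ]
      ring
    intro x hx y hy
    rcases le_total x y with h | h
    · exact key x hx y hy h
    · rw [edist_comm (Φ (θ x)), edist_comm x]
      exact key y hy x hx h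

/-- A Lipschitz curve is a primitive of a bounded function. -/
theorem exists_isPrimitiveOn_of_lipschitzOnWith {n : ℕ} {τ : ℝ → Rn n} {a b : ℝ} {K : NNReal}
    (hab : a ≤ b) (hτ : LipschitzOnWith K τ (Icc a b)) :
    IsPrimitiveOn a b τ (deriv τ) ∧ MemLp (deriv τ) 2 (volume.restrict (Ioo a b)) ∧
      ∀ t ∈ Ioo a b, ‖deriv τ t‖ ≤ K := by
  have hbound : ∀ t ∈ Ioo a b, ‖deriv τ t‖ ≤ K := fun t ht =>
    norm_deriv_le_of_lipschitzOn (Icc_mem_nhds ht.1 ht.2) hτ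
  have hL : MemLp (deriv τ) 2 (volume.restrict (Ioo a b)) :=
    MemLp.of_bound (stronglyMeasurable_deriv τ).aestronglyMeasurable K
      ((ae_restrict_iff' measurableSet_Ioo).2 (Eventually.of_forall hbound))
  refine ⟨?_, hL, hbound⟩
  refine IsPrimitiveOn.of_absolutelyContinuousOnInterval hab
    (LipschitzOnWith.absolutelyContinuousOnInterval (K := K) (by rwa [uIcc_of_le hab]))
    (hL.intervalIntegrable_Ioo hab) ?_
  filter_upwards [hτ.ae_differentiableWithinAt_of_mem_real] with t ht htI
  exact ((ht (Ioo_subset_Icc_self htI)).differentiableAt (Icc_mem_nhds htI.1 htI.2)).hasDerivAt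

/-- Cauchy-Schwarz, from the nonnegative integral of `(‖g‖ - m)²` with `m` the mean of `‖g‖`. -/
theorem sq_integral_norm_le {E : Type*} [NormedAddCommGroup E] {g : ℝ → E} {a b : ℝ} (hab : a < b)
    (hg : MemLp g 2 (volume.restrict (Ioo a b))) :
    (∫ t in a..b, ‖g t‖) ^ 2 ≤ (b - a) * ∫ t in a..b, ‖g t‖ ^ 2 := by
  have h1 := (hg.intervalIntegrable_Ioo hab.le).norm
  have h2 := hg.intervalIntegrable_norm_sq hab.le
  set A := ∫ t in a..b, ‖g t‖
  set m := A / (b - a)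
  have hba : 0 < b - a := sub_pos.2 hab
  have h3 : 0 ≤ ∫ t in a..b, (‖g t‖ ^ 2 - 2 * m * ‖g t‖ + m ^ 2) :=
    intervalIntegral.integral_nonneg hab.le fun t _ => by
      have := sq_nonneg (‖g t‖ - m)
      nlinarith
  rw [intervalIntegral.integral_add (h2.sub (h1.const_mul _)) intervalIntegrable_const,
    intervalIntegral.integral_sub h2 (h1.const_mul _), intervalIntegral.integral_const_mul,
    intervalIntegral.integral_const, smul_eq_mul] at h3
  have h4 : A = m * (b - a) := by
    simp only [m]
    field_simp
  nlinarith

/-- An arc of a minimizer of the energy is not longer than the curves avoiding `O` that join its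
end points. -/
theorem IsEnergyMinimizer.eVariationOn_le {n : ℕ} {O : Set (Rn n)} {p q : Rn n} {u : ℝ → Rn n}
    (hu : IsEnergyMinimizer O p q u) {a b : ℝ} (ha : 0 ≤ a) (hab : a < b) (hb : b ≤ 1)
    {σ : ℝ → Rn n} (hσ : ContinuousOn σ (Icc a b)) (hO : ∀ t ∈ Icc a b, σ t ∉ O)
    (hσa : σ a = u a) (hσb : σ b = u b) :
    eVariationOn u (Icc a b) ≤ eVariationOn σ (Icc a b) := by
  by_cases hL : eVariationOn σ (Icc a b) = ⊤
  · rw [hL]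
    exact le_top
  obtain ⟨τ, hτa, hτb, hτm, hτ⟩ := exists_lipschitzOnWith_reparametrization hab hσ hL
  set l := (eVariationOn σ (Icc a b)).toReal with hl
  have hl0 : 0 ≤ l := ENNReal.toReal_nonneg
  have hba : 0 < b - a := sub_pos.2 hab
  obtain ⟨hp, hpL, hpb⟩ := exists_isPrimitiveOn_of_lipschitzOnWith hab.le hτ
  have hmin := hu.integral_norm_sq_le ha hab.le hb hp hpL (hτa.trans hσa) (hτb.trans hσb)
    (fun t ht => by
      obtain ⟨s, hs, he⟩ := hτm ht
      rw [← he]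
      exact hO s hs)
  have hK : ((l / (b - a)).toNNReal : ℝ) = l / (b - a) := Real.coe_toNNReal _ (by positivity)
  have hle : ∫ t in a..b, ‖deriv τ t‖ ^ 2 ≤ (b - a) * (l / (b - a)) ^ 2 := by
    have := intervalIntegral.integral_mono_on_of_le_Ioo hab.le
      (hpL.intervalIntegrable_norm_sq hab.le)
      (intervalIntegrable_const (c := (l / (b - a)) ^ 2)) (fun t ht => by
        have := hpb t ht
        rw [hK] at this
        gcongr)
    rwa [intervalIntegral.integral_const, smul_eq_mul] at this
  have hgL := hu.memLp_of_le ha hb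
  have hcs := sq_integral_norm_le hab hgL
  -- The speed bound `l / (b - a)` makes the rival's energy at most `l² / (b - a)`, exactly what
  -- Cauchy-Schwarz needs to bound the integral of `‖u'‖` by `l`.
  have hfin : ∫ t in a..b, ‖weakDeriv u t‖ ≤ l := by
    refine le_of_sq_le_sq ?_ hl0
    calc (∫ t in a..b, ‖weakDeriv u t‖) ^ 2 ≤ (b - a) * ∫ t in a..b, ‖weakDeriv u t‖ ^ 2 := hcs
      _ ≤ (b - a) * ((b - a) * (l / (b - a)) ^ 2) := by
          gcongr
          exact hmin.trans hle
      _ = l ^ 2 := by field_simp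
  calc eVariationOn u (Icc a b) ≤ ENNReal.ofReal (∫ t in a..b, ‖weakDeriv u t‖) :=
        (hu.isPrimitiveOn.mono ha hab.le hb).eVariationOn_le hab.le
    _ ≤ ENNReal.ofReal l := ENNReal.ofReal_le_ofReal hfin
    _ = eVariationOn σ (Icc a b) := ENNReal.ofReal_toReal hL

end Length

end Obstacle

/-! ### The structure theorem for minimizers -/

theorem theorem1p3 {n : ℕ} (O : Set (Obstacle.Rn n))
    (hO_open : IsOpen O) (hO_convex : Convex ℝ O) (hO_bdd : Bornology.IsBounded O)
    (hO_smooth : Obstacle.HasSmoothBoundary O)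
    (p q : Obstacle.Rn n) (hp : p ∉ closure O) (hq : q ∉ closure O)
    (hpq : (segment ℝ p q ∩ O).Nonempty)
    (u : ℝ → Obstacle.Rn n) (hu : Obstacle.IsEnergyMinimizer O p q u) :
    ∃ a b : ℝ, 0 < a ∧ a < b ∧ b < 1 ∧
      {t : ℝ | t ∈ Icc (0 : ℝ) 1 ∧ u t ∈ frontier O} = Icc a b ∧
      u a ∈ Obstacle.visionBoundary O p ∧
      u b ∈ Obstacle.visionBoundary O q ∧
      (∀ t ∈ Icc 0 a, u t = AffineMap.lineMap p (u a) (t / a)) ∧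
      Obstacle.IsMinimizingGeodesicOn (frontier O) u a b ∧
      (∀ t ∈ Icc b 1, u t = AffineMap.lineMap (u b) q ((t - b) / (1 - b))) := by
  have h0 : u 0 = p := hu.1.2.2.1
  have h1 : u 1 = q := hu.1.2.2.2.1
  obtain ⟨a, b, ha, hab, hb, hcoin, hΓa, hΓb, hlina, hlinb⟩ :=
    hu.isTaut.exists_coincidence hO_open hO_convex hO_smooth (h0 ▸ hp) (h1 ▸ hq)
      (by rwa [h0, h1])
  rw [h0] at hΓa hlina
  rw [h1] at hΓb hlinb
  have hfr : ∀ t ∈ Icc a b, u t ∈ frontier O := fun t ht => by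
    rw [← hcoin] at ht
    exact ht.2
  refine ⟨a, b, ha, hab, hb, hcoin, hΓa, hΓb, hlina,
    ⟨hu.isGeodesicOn hO_open hO_convex hO_smooth ha.le hab hb.le hfr, ?_⟩, hlinb⟩
  intro σ hσ hσO hσa hσb
  refine hu.eVariationOn_le ha.le hab hb.le hσ (fun t ht => ?_) hσa hσb
  have := hσO t ht
  rw [hO_open.frontier_eq] at this
  exact this.2
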